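/- Let $\mathfrak g=\mathfrak g_{\bar 0}\oplus\mathfrak g_{\bar 1}$ be a finite-dimensional Lie superalgebra over $\mathbb C$ with an even, invariant, supersymmetric, non-degenerate bilinear form $(\cdot\mid\cdot)$ (invariance means $([x,y]\mid w)=(x\mid[y,w])$). Let $\{e_i\}$ be a homogeneous basis of $\mathfrak g$, $a_{ij}=(e_i\mid e_j)$ and $(b_{ij})=(a_{ij})^{-1}$. Let $$\widehat{\mathfrak g}=\mathfrak g\otimes\mathbb C[t,t^{-1}]\oplus\mathbb C u\oplus\mathbb C z\qquad(u,z\text{ even})$$ be the Kac–Moody superalgebra with bracket $[t^mx,t^ny]=t^{m+n}[x,y]+m\,\delta_{m,-n}(x\mid y)z$, $[u,t^nx]=n\,t^nx$, $z$ central; the degree of an element of $\widehat{\mathfrak g}$ is its eigenvalue under $\operatorname{ad}u$. Let $\widehat U=\varprojlim_N U(\widehat{\mathfrak g})/U(\widehat{\mathfrak g})\,t^N\mathfrak g[t]$ be the completed enveloping algebra, i.e. the completion of the enveloping algebra $U(\widehat{\mathfrak g})$ in the topology in which the left ideals $U(\widehat{\mathfrak g})\,t^N\mathfrak g[t]$,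 $N\ge 0$, form a neighbourhood basis of $0$. Put $$\Omega_0=\sum_{i,j}b_{ij}\,e_i\otimes e_j,\qquad \Omega^{pm}=\sum_{n=1}^{\infty}\sum_{i,j}b_{ij}\,t^{-n}e_i\otimes t^ne_j,$$ where $\otimes$ denotes the product in $\widehat U$. A rule for ordering the basis of $\mathfrak g$ is a relation saying, for each pair $(i,j)$, whether $e_i\otimes e_j$ is an allowed product, such that for $i\ne j$ at least one of $e_i\otimes e_j$, $e_j\otimes e_i$ is allowed, and $e_i\otimes e_i$ is allowed for $e_i$ even (for instance: everything is allowed; or the order is that of a linear order on the basis). A Wick normal form of $w\in\widehat U$, with linear term $\ell\in\widehat{\mathfrak g}$, is an expression $w=\sum c_{XY}\,X\otimes Y+\ell$, a convergent, possibly infinite, sum over pairs $X,Y$ of elements of the basis $\{t^ne_i,\ u,\ z\}$ of $\widehat{\mathfrak g}$, such that whenever $c_{XY}\neq0$ the first factor $X$ has degree $\le 0$, the second factor $Y$ has degree $\ge 0$, and the product $X\otimes Y$ is allowed by the rule if $X=e_i$, $Y=e_j$. Suppose that for some $\lambda\in\mathbb C$ the operator $A(x)=\sum_{i,j}b_{ij}[[x,e_i],e_j]$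 on $\mathfrak g$ equals $\lambda\cdot\mathrm{id}$. Then the series $\Omega^{pm}$ converges in $\widehat U$, and: 1. the element $\Omega=\Omega_0+2\,\Omega^{pm}+2\,u\otimes z+\lambda u$ lies in the center of $\widehat U$; 2. for every ordering rule, both $\Omega_0$ and $\Omega$ have Wick normal forms; 3. for every ordering rule, the linear terms of the Wick normal forms of $\Omega_0$ and $\Omega$ differ by $\lambda u$: an element $\ell_0\in\widehat{\mathfrak g}$ is the linear term of a Wick normal form of $\Omega_0$ if and only if $\ell_0+\lambda u$ is the linear term of a Wick normal form of $\Omega$; moreover, for any linear terms $\ell_0$ and $\ell$ of Wick normal forms of $\Omega_0$ and $\Omega$, respectively, the coefficient of $u$ in $\ell$ exceeds that in $\ell_0$ by exactly $\lambda$. -/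

import Mathlib

noncomputable section

namespace KacMoodySuper

/-! ### Lie superalgebras over `ℂ` and their enveloping algebras -/

/-- The Koszul sign `(-1)^{ab}`. -/
def koszul (a b : ZMod 2) : ℂ := if a = 1 ∧ b = 1 then -1 else 1

/-- A Lie superalgebra over `ℂ`: a `ℤ/2`-graded space `part 0 ⊕ part 1` with an even bilinear
bracket that is super-antisymmetric and satisfies the super Jacobi identity. -/
class LieSuperalgebra (L : Type*) [AddCommGroup L] [Module ℂ L] where
  part : ZMod 2 → Submodule ℂ L
  isCompl : IsCompl (part 0) (part 1)
  br : L →ₗ[ℂ] L →ₗ[ℂ] L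
  br_mem : ∀ {a b : ZMod 2} {x y : L}, x ∈ part a → y ∈ part b → br x y ∈ part (a + b)
  br_skew : ∀ {a b : ZMod 2} {x y : L}, x ∈ part a → y ∈ part b →
    br x y = -(koszul a b • br y x)
  jacobi : ∀ {a b c : ZMod 2} {x y z : L}, x ∈ part a → y ∈ part b → z ∈ part c →
    br x (br y z) = br (br x y) z + koszul a b • br y (br x z)

open LieSuperalgebra

/-- The defining relations `x y - (-1)^{p(x)p(y)} y x = [x, y]` of the enveloping algebra
(`x`, `y` homogeneous). -/
inductive EnvRel (L : Type*) [AddCommGroup L] [Module ℂ L] [LieSuperalgebra L] :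
    TensorAlgebra ℂ L → TensorAlgebra ℂ L → Prop
  | comm {a b : ZMod 2} {x y : L} (hx : x ∈ part a) (hy : y ∈ part b) :
      EnvRel L (TensorAlgebra.ι ℂ x * TensorAlgebra.ι ℂ y)
        (koszul a b • (TensorAlgebra.ι ℂ y * TensorAlgebra.ι ℂ x)
          + TensorAlgebra.ι ℂ (br x y))

/-- The universal enveloping algebra `U(L)` of a Lie superalgebra. -/
def Env (L : Type*) [AddCommGroup L] [Module ℂ L] [LieSuperalgebra L] : Type _ :=
  RingQuot (EnvRel L)

section Env

variable (L : Type*) [AddCommGroup L] [Module ℂ L] [LieSuperalgebra L]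

instance : Ring (Env L) := inferInstanceAs (Ring (RingQuot (EnvRel L)))

instance : Algebra ℂ (Env L) := inferInstanceAs (Algebra ℂ (RingQuot (EnvRel L)))

/-- The projection of the tensor algebra onto the enveloping algebra. -/
def Env.mk : TensorAlgebra ℂ L →ₐ[ℂ] Env L := RingQuot.mkAlgHom ℂ (EnvRel L)

/-- The canonical map `L → U(L)`. -/
def Env.inc : L →ₗ[ℂ] Env L := (Env.mk L).toLinearMap ∘ₗ TensorAlgebra.ι ℂ

variable {L}

theorem Env.inc_mul {a b : ZMod 2} {x y : L} (hx : x ∈ part a) (hy : y ∈ part b) :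
    Env.inc L x * Env.inc L y
      = koszul a b • (Env.inc L y * Env.inc L x) + Env.inc L (br x y) := by
  have h := RingQuot.mkAlgHom_rel ℂ (EnvRel.comm hx hy)
  rw [map_mul, map_add, map_smul, map_mul] at h
  exact h

theorem Env.induction {P : Env L → Prop} (hc : ∀ r : ℂ, P (algebraMap ℂ (Env L) r))
    (hi : ∀ x, P (Env.inc L x)) (hm : ∀ x y, P x → P y → P (x * y))
    (ha : ∀ x y, P x → P y → P (x + y)) (w : Env L) : P w := by
  obtain ⟨w, rfl⟩ : ∃ w', Env.mk L w' = w := RingQuot.mkAlgHom_surjective ℂ (EnvRel L) w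
  induction w using TensorAlgebra.induction with
  | algebraMap r => rw [AlgHom.commutes]; exact hc r
  | ι x => exact hi x
  | mul x y hx hy => rw [map_mul]; exact hm _ _ hx hy
  | add x y hx hy => rw [map_add]; exact ha _ _ hx hy

theorem exists_add_part (x : L) : ∃ y ∈ part (L := L) 0, ∃ z ∈ part (L := L) 1, y + z = x :=
  Submodule.mem_sup.1 (isCompl (L := L).sup_eq_top ▸ Submodule.mem_top)

end Env

/-! ### Invariant forms and the Kac–Moody superalgebra -/

/-- An even invariant non-degenerate supersymmetric bilinear form on a Lie superalgebra. -/
structure InvariantForm (g : Type*) [AddCommGroup g] [Module ℂ g] [LieSuperalgebra g] where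
  form : g →ₗ[ℂ] g →ₗ[ℂ] ℂ
  even : ∀ {a b : ZMod 2} {x y : g}, a ≠ b → x ∈ part a → y ∈ part b → form x y = 0
  supersymm : ∀ {a b : ZMod 2} {x y : g}, x ∈ part a → y ∈ part b →
    form x y = koszul a b * form y x
  invariant : ∀ x y z : g, form (br x y) z = form x (br y z)
  nondegenerate : form.Nondegenerate

/-- The space `ĝ = g ⊗ ℂ[t, t⁻¹] ⊕ ℂ u ⊕ ℂ z` attached to `g` and a form on it. An element
`∑ tⁿ xₙ + α u + β z` is stored as the finitely supported function `n ↦ xₙ` together with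
`α` and `β`. -/
@[ext]
structure KM {g : Type*} [AddCommGroup g] [Module ℂ g] [LieSuperalgebra g]
    (F : InvariantForm g) where
  loops : ℤ →₀ g
  uCoeff : ℂ
  zCoeff : ℂ

section KM

variable {g : Type*} [AddCommGroup g] [Module ℂ g] [LieSuperalgebra g] (F : InvariantForm g)

/-- `KM F` as a product, used to transport the vector space structure. -/
def KM.equivProd : KM F ≃ (ℤ →₀ g) × ℂ × ℂ where
  toFun X := (X.loops, X.uCoeff, X.zCoeff)
  invFun p := ⟨p.1, p.2.1, p.2.2⟩
  left_inv _ := rfl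
  right_inv _ := rfl

instance : AddCommGroup (KM F) := (KM.equivProd F).addCommGroup

instance : Module ℂ (KM F) := (KM.equivProd F).module ℂ

/-- `KM F` is linearly the product of its three components. -/
def KM.linearEquivProd : KM F ≃ₗ[ℂ] (ℤ →₀ g) × ℂ × ℂ := (KM.equivProd F).linearEquiv ℂ

/-- The inclusion of the loop space `g ⊗ ℂ[t, t⁻¹]`. -/
def KM.ofLoops : (ℤ →₀ g) →ₗ[ℂ] KM F :=
  (KM.linearEquivProd F).symm.toLinearMap ∘ₗ LinearMap.inl ℂ (ℤ →₀ g) (ℂ × ℂ)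

/-- The element `tⁿ x`. -/
def KM.loop (n : ℤ) : g →ₗ[ℂ] KM F := KM.ofLoops F ∘ₗ Finsupp.lsingle n

/-- The element `u = t d/dt`. -/
def KM.u : KM F := ⟨0, 1, 0⟩

/-- The element `z`. -/
def KM.z : KM F := ⟨0, 0, 1⟩

variable {F}

@[simp] theorem KM.add_loops (X Y : KM F) : (X + Y).loops = X.loops + Y.loops := rfl
@[simp] theorem KM.add_uCoeff (X Y : KM F) : (X + Y).uCoeff = X.uCoeff + Y.uCoeff := rfl
@[simp] theorem KM.add_zCoeff (X Y : KM F) : (X + Y).zCoeff = X.zCoeff + Y.zCoeff := rfl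
@[simp] theorem KM.smul_loops (c : ℂ) (X : KM F) : (c • X).loops = c • X.loops := rfl
@[simp] theorem KM.smul_uCoeff (c : ℂ) (X : KM F) : (c • X).uCoeff = c * X.uCoeff := rfl
@[simp] theorem KM.smul_zCoeff (c : ℂ) (X : KM F) : (c • X).zCoeff = c * X.zCoeff := rfl
@[simp] theorem KM.zero_loops : (0 : KM F).loops = 0 := rfl
@[simp] theorem KM.zero_uCoeff : (0 : KM F).uCoeff = 0 := rfl
@[simp] theorem KM.zero_zCoeff : (0 : KM F).zCoeff = 0 := rfl
@[simp] theorem KM.ofLoops_loops (f : ℤ →₀ g) : (KM.ofLoops F f).loops = f := rfl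
@[simp] theorem KM.ofLoops_uCoeff (f : ℤ →₀ g) : (KM.ofLoops F f).uCoeff = 0 := rfl
@[simp] theorem KM.ofLoops_zCoeff (f : ℤ →₀ g) : (KM.ofLoops F f).zCoeff = 0 := rfl
@[simp] theorem KM.loop_loops (n : ℤ) (x : g) :
    (KM.loop F n x).loops = Finsupp.single n x := rfl
@[simp] theorem KM.loop_uCoeff (n : ℤ) (x : g) : (KM.loop F n x).uCoeff = 0 := rfl
@[simp] theorem KM.loop_zCoeff (n : ℤ) (x : g) : (KM.loop F n x).zCoeff = 0 := rfl
@[simp] theorem KM.u_loops : (KM.u F).loops = 0 := rfl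
@[simp] theorem KM.u_uCoeff : (KM.u F).uCoeff = 1 := rfl
@[simp] theorem KM.u_zCoeff : (KM.u F).zCoeff = 0 := rfl
@[simp] theorem KM.z_loops : (KM.z F).loops = 0 := rfl
@[simp] theorem KM.z_uCoeff : (KM.z F).uCoeff = 0 := rfl
@[simp] theorem KM.z_zCoeff : (KM.z F).zCoeff = 1 := rfl

theorem KM.eq_sum (X : KM F) :
    X = KM.ofLoops F X.loops + X.uCoeff • KM.u F + X.zCoeff • KM.z F := by
  ext <;> simp

variable (F)

/-- `(x, y) ↦ [tᵐ x, tⁿ y] = tᵐ⁺ⁿ [x, y] + m δ_{m,-n} (x | y) z`. -/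
def KM.loopBr (m n : ℤ) : g →ₗ[ℂ] g →ₗ[ℂ] KM F :=
  (br (L := g)).compr₂ (KM.loop F (m + n))
    + F.form.compr₂ (LinearMap.toSpanSingleton ℂ (KM F)
        ((if m = -n then (m : ℂ) else 0) • KM.z F))

/-- The bracket restricted to the loop space. -/
def KM.loopsBr : (ℤ →₀ g) →ₗ[ℂ] (ℤ →₀ g) →ₗ[ℂ] KM F :=
  Finsupp.lsum ℂ fun m => (Finsupp.lsum ℂ fun n => (KM.loopBr F m n).flip).flip

/-- `tⁿ x ↦ n tⁿ x`. -/
def KM.degMap : (ℤ →₀ g) →ₗ[ℂ] KM F :=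
  Finsupp.lsum ℂ fun n => (n : ℂ) • KM.loop F n

/-- The bracket of the Kac–Moody superalgebra: `[tᵐ x, tⁿ y]` as in `KM.loopBr`,
`[u, tⁿ x] = n tⁿ x = -[tⁿ x, u]`, all the other brackets of generators being zero. -/
def KM.bracket : KM F →ₗ[ℂ] KM F →ₗ[ℂ] KM F :=
  LinearMap.mk₂ ℂ
    (fun X Y => KM.loopsBr F X.loops Y.loops + X.uCoeff • KM.degMap F Y.loops
      - Y.uCoeff • KM.degMap F X.loops)
    (fun X X' Y => by simp only [KM.add_loops, KM.add_uCoeff, map_add, LinearMap.add_apply]; module)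
    (fun c X Y => by
      simp only [KM.smul_loops, KM.smul_uCoeff, map_smul, LinearMap.smul_apply]; module)
    (fun X Y Y' => by simp only [KM.add_loops, KM.add_uCoeff, map_add]; module)
    (fun c X Y => by simp only [KM.smul_loops, KM.smul_uCoeff, map_smul]; module)

variable {F}

theorem KM.bracket_apply (X Y : KM F) :
    KM.bracket F X Y = KM.loopsBr F X.loops Y.loops + X.uCoeff • KM.degMap F Y.loops
      - Y.uCoeff • KM.degMap F X.loops := rfl

theorem KM.bracket_loop_loop (m n : ℤ) (x y : g) :
    KM.bracket F (KM.loop F m x) (KM.loop F n y)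
      = KM.loop F (m + n) (br x y)
        + (if m = -n then (m : ℂ) else 0) • F.form x y • KM.z F := by
  rw [KM.bracket_apply]
  simp only [KM.loop_loops, KM.loop_uCoeff, zero_smul, add_zero, sub_zero]
  simp only [KM.loopsBr, KM.loopBr, Finsupp.lsum_apply, Finsupp.sum_single_index, map_zero,
    LinearMap.flip_apply, LinearMap.add_apply, LinearMap.compr₂_apply,
    LinearMap.toSpanSingleton_apply]
  rw [smul_comm]

theorem KM.bracket_u_loop (n : ℤ) (x : g) :
    KM.bracket F (KM.u F) (KM.loop F n x) = (n : ℂ) • KM.loop F n x := by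
  simp [KM.bracket_apply, KM.degMap]

theorem KM.bracket_loop_u (n : ℤ) (x : g) :
    KM.bracket F (KM.loop F n x) (KM.u F) = -((n : ℂ) • KM.loop F n x) := by
  simp [KM.bracket_apply, KM.degMap]

theorem KM.bracket_u_u : KM.bracket F (KM.u F) (KM.u F) = 0 := by
  simp [KM.bracket_apply]

theorem KM.bracket_z_left (X : KM F) : KM.bracket F (KM.z F) X = 0 := by
  simp [KM.bracket_apply]

theorem KM.bracket_z_right (X : KM F) : KM.bracket F X (KM.z F) = 0 := by
  simp [KM.bracket_apply]

variable (F)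

/-- Parity on `ĝ`: the parity of `tⁿ x` is that of `x`, and `u`, `z` are even. -/
def KM.part (a : ZMod 2) : Submodule ℂ (KM F) where
  carrier := {X | (∀ n, X.loops n ∈ LieSuperalgebra.part (L := g) a) ∧
    (a ≠ 0 → X.uCoeff = 0 ∧ X.zCoeff = 0)}
  add_mem' {X Y} hX hY := ⟨fun n => add_mem (hX.1 n) (hY.1 n), fun h => by
    simp [hX.2 h, hY.2 h]⟩
  zero_mem' := ⟨fun n => by simp, fun h => by simp⟩
  smul_mem' c X hX := ⟨fun n => Submodule.smul_mem _ c (hX.1 n), fun h => by simp [hX.2 h]⟩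

variable {F}

theorem KM.mem_part {a : ZMod 2} {X : KM F} : X ∈ KM.part F a ↔
    (∀ n, X.loops n ∈ LieSuperalgebra.part (L := g) a) ∧
      (a ≠ 0 → X.uCoeff = 0 ∧ X.zCoeff = 0) := Iff.rfl

theorem KM.loop_mem_part {a : ZMod 2} (n : ℤ) {x : g} (hx : x ∈ LieSuperalgebra.part a) :
    KM.loop F n x ∈ KM.part F a := by
  refine ⟨fun k => ?_, fun _ => by simp⟩
  rw [KM.loop_loops, Finsupp.single_apply]
  split_ifs <;> simp [hx]

theorem KM.u_mem_part : KM.u F ∈ KM.part F 0 := ⟨fun n => by simp, fun h => absurd rfl h⟩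

theorem KM.z_mem_part : KM.z F ∈ KM.part F 0 := ⟨fun n => by simp, fun h => absurd rfl h⟩

/-- Induction on homogeneous elements of `ĝ`. -/
theorem KM.part_induction {a : ZMod 2} {P : (X : KM F) → X ∈ KM.part F a → Prop}
    (zero : P 0 (zero_mem _))
    (add : ∀ X Y {hX : X ∈ KM.part F a} {hY : Y ∈ KM.part F a}, P X hX → P Y hY →
      P (X + Y) (add_mem hX hY))
    (smul : ∀ (c : ℂ) X {hX : X ∈ KM.part F a}, P X hX → P (c • X) (Submodule.smul_mem _ c hX))
    (loop : ∀ (n : ℤ) (x : g) (hx : x ∈ LieSuperalgebra.part (L := g) a),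
      P (KM.loop F n x) (KM.loop_mem_part n hx))
    (u : ∀ h : a = 0, P (KM.u F) (h ▸ KM.u_mem_part))
    (z : ∀ h : a = 0, P (KM.z F) (h ▸ KM.z_mem_part))
    {X : KM F} (hX : X ∈ KM.part F a) : P X hX := by
  suffices h : ∃ h : X ∈ KM.part F a, P X h from h.2
  have hadd : ∀ X Y : KM F, (∃ h, P X h) → (∃ h, P Y h) → ∃ h, P (X + Y) h :=
    fun X Y ⟨_, hX⟩ ⟨_, hY⟩ => ⟨_, add X Y hX hY⟩
  have hsmul : ∀ (c : ℂ) (X : KM F), (∃ h, P X h) → ∃ h, P (c • X) h :=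
    fun c X ⟨_, hX⟩ => ⟨_, smul c X hX⟩
  rw [KM.eq_sum X]
  have h1 : ∃ h, P (KM.ofLoops F X.loops) h := by
    rw [← Finsupp.sum_single X.loops, Finsupp.sum, map_sum]
    exact Finset.sum_induction _ (fun Y => ∃ h, P Y h) hadd ⟨_, zero⟩
      fun n _ => ⟨_, loop n _ (hX.1 n)⟩
  by_cases ha : a = 0
  · exact hadd _ _ (hadd _ _ h1 (hsmul _ _ ⟨_, u ha⟩)) (hsmul _ _ ⟨_, z ha⟩)
  · rw [(hX.2 ha).1, (hX.2 ha).2]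
    simpa using h1

theorem KM.isCompl_part : IsCompl (KM.part F 0) (KM.part F 1) := by
  constructor
  · rw [Submodule.disjoint_def]
    intro X h0 h1
    have h2 := h1.2 one_ne_zero
    ext n
    · exact Submodule.disjoint_def.1 (LieSuperalgebra.isCompl (L := g)).disjoint _
        (h0.1 n) (h1.1 n)
    · exact h2.1
    · exact h2.2
  · rw [codisjoint_iff, eq_top_iff]
    intro X _
    rw [KM.eq_sum X]
    refine add_mem (add_mem ?_ ?_) ?_
    · rw [← Finsupp.sum_single X.loops, Finsupp.sum, map_sum]
      refine sum_mem fun n _ => ?_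
      obtain ⟨y, hy, w, hw, h⟩ := exists_add_part (X.loops n)
      have : KM.ofLoops F (Finsupp.single n (X.loops n)) = KM.loop F n y + KM.loop F n w := by
        rw [← map_add, h]; rfl
      rw [this]
      exact Submodule.add_mem_sup (KM.loop_mem_part n hy) (KM.loop_mem_part n hw)
    · exact Submodule.smul_mem _ _ (Submodule.mem_sup_left KM.u_mem_part)
    · exact Submodule.smul_mem _ _ (Submodule.mem_sup_left KM.z_mem_part)

theorem koszul_zero_left (b : ZMod 2) : koszul 0 b = 1 := by simp [koszul]

theorem koszul_zero_right (a : ZMod 2) : koszul a 0 = 1 := by simp [koszul]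

theorem KM.bracket_mem {a b : ZMod 2} {X Y : KM F} (hX : X ∈ KM.part F a)
    (hY : Y ∈ KM.part F b) : KM.bracket F X Y ∈ KM.part F (a + b) := by
  induction hX using KM.part_induction with
  | zero => simp
  | add X X' h h' => simpa using add_mem h h'
  | smul c X h => simpa using Submodule.smul_mem _ c h
  | z ha => simp [KM.bracket_z_left]
  | loop m x hx =>
    induction hY using KM.part_induction with
    | zero => simp
    | add X X' h h' => simpa using add_mem h h'
    | smul c X h => simpa using Submodule.smul_mem _ c h
    | z ha => simp [KM.bracket_z_right]
    | u hb =>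
      subst hb
      rw [KM.bracket_loop_u, add_zero]
      exact neg_mem (Submodule.smul_mem _ _ (KM.loop_mem_part m hx))
    | loop n y hy =>
      rw [KM.bracket_loop_loop]
      refine add_mem (KM.loop_mem_part _ (br_mem hx hy)) (Submodule.smul_mem _ _ ?_)
      by_cases hab : a = b
      · subst hab
        rw [CharTwo.add_self_eq_zero]
        exact Submodule.smul_mem _ _ KM.z_mem_part
      · simp [F.even hab hx hy]
  | u ha =>
    subst ha
    induction hY using KM.part_induction with
    | zero => simp
    | add X X' h h' => simpa using add_mem h h'
    | smul c X h => simpa using Submodule.smul_mem _ c h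
    | z ha => simp [KM.bracket_z_right]
    | u hb => simp [KM.bracket_u_u]
    | loop n y hy =>
      rw [KM.bracket_u_loop, zero_add]
      exact Submodule.smul_mem _ _ (KM.loop_mem_part n hy)

theorem KM.bracket_skew {a b : ZMod 2} {X Y : KM F} (hX : X ∈ KM.part F a)
    (hY : Y ∈ KM.part F b) : KM.bracket F X Y = -(koszul a b • KM.bracket F Y X) := by
  induction hX using KM.part_induction with
  | zero => simp
  | add X X' h h' => simp only [map_add, LinearMap.add_apply, h, h']; module
  | smul c X h => simp only [map_smul, LinearMap.smul_apply, h]; module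
  | z ha => simp [KM.bracket_z_left, KM.bracket_z_right]
  | loop m x hx =>
    induction hY using KM.part_induction with
    | zero => simp
    | add X X' h h' => simp only [map_add, LinearMap.add_apply, h, h']; module
    | smul c X h => simp only [map_smul, LinearMap.smul_apply, h]; module
    | z ha => simp [KM.bracket_z_left, KM.bracket_z_right]
    | u hb =>
      subst hb
      rw [KM.bracket_loop_u, KM.bracket_u_loop, koszul_zero_right, one_smul]
    | loop n y hy =>
      rw [KM.bracket_loop_loop, KM.bracket_loop_loop, br_skew hx hy, F.supersymm hx hy,
        add_comm n m]
      by_cases h : m = -n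
      · have h' : n = -m := by omega
        rw [if_pos h, if_pos h', h, map_neg, map_smul]
        push_cast
        module
      · have h' : n ≠ -m := by omega
        rw [if_neg h, if_neg h', map_neg, map_smul]
        module
  | u ha =>
    subst ha
    induction hY using KM.part_induction with
    | zero => simp
    | add X X' h h' => simp only [map_add, LinearMap.add_apply, h, h']; module
    | smul c X h => simp only [map_smul, LinearMap.smul_apply, h]; module
    | z ha => simp [KM.bracket_z_left, KM.bracket_z_right]
    | u hb => simp [KM.bracket_u_u]
    | loop n y hy =>
      rw [KM.bracket_loop_u, KM.bracket_u_loop, koszul_zero_left, one_smul, neg_neg]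

theorem KM.bracket_jacobi_loop {a b c : ZMod 2} {x y w : g}
    (hx : x ∈ LieSuperalgebra.part a) (hy : y ∈ LieSuperalgebra.part b)
    (hw : w ∈ LieSuperalgebra.part c) (m n k : ℤ) :
    KM.bracket F (KM.loop F m x) (KM.bracket F (KM.loop F n y) (KM.loop F k w))
      = KM.bracket F (KM.bracket F (KM.loop F m x) (KM.loop F n y)) (KM.loop F k w)
        + koszul a b • KM.bracket F (KM.loop F n y)
          (KM.bracket F (KM.loop F m x) (KM.loop F k w)) := by
  simp only [KM.bracket_loop_loop, map_add, map_smul, LinearMap.add_apply, LinearMap.smul_apply,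
    KM.bracket_z_left, KM.bracket_z_right, smul_zero, add_zero, jacobi hx hy hw]
  have e1 : F.form (br x y) w = F.form x (br y w) := F.invariant x y w
  have e2 : koszul a b * F.form y (br x w) = -F.form x (br y w) := by
    rw [← F.invariant y x w, br_skew hy hx, ← F.invariant x y w, koszul, koszul]
    by_cases h : a = 1 ∧ b = 1
    · simp [h]
    · have h' : ¬ (b = 1 ∧ a = 1) := fun t => h ⟨t.2, t.1⟩
      simp [h, h']
  have e3 : m + n + k = m + (n + k) := by ring
  have e4 : n + (m + k) = m + (n + k) := by ring
  rw [e1, e3, e4]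
  by_cases h : m + n + k = 0
  · rw [if_pos (by omega), if_pos (by omega), if_pos (by omega)]
    push_cast
    have : koszul a b • ((n : ℂ) • F.form y (br x w) • KM.z F)
        = -((n : ℂ) • F.form x (br y w) • KM.z F) := by
      rw [smul_comm, smul_smul (koszul a b), e2]; module
    rw [smul_add, this]
    module
  · rw [if_neg (by omega), if_neg (by omega), if_neg (by omega)]
    module

theorem KM.bracket_jacobi {a b c : ZMod 2} {X Y Z : KM F} (hX : X ∈ KM.part F a)
    (hY : Y ∈ KM.part F b) (hZ : Z ∈ KM.part F c) :
    KM.bracket F X (KM.bracket F Y Z)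
      = KM.bracket F (KM.bracket F X Y) Z + koszul a b • KM.bracket F Y (KM.bracket F X Z) := by
  induction hX using KM.part_induction with
  | zero => simp
  | add X X' h h' => simp only [map_add, LinearMap.add_apply, h, h']; module
  | smul c X h => simp only [map_smul, LinearMap.smul_apply, h]; module
  | z ha => simp [KM.bracket_z_left]
  | loop m x hx =>
    induction hY using KM.part_induction with
    | zero => simp
    | add X X' h h' => simp only [map_add, LinearMap.add_apply, h, h']; module
    | smul c X h => simp only [map_smul, LinearMap.smul_apply, h]; module
    | z ha => simp [KM.bracket_z_left, KM.bracket_z_right]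
    | u hb =>
      subst hb
      induction hZ using KM.part_induction with
      | zero => simp
      | add X X' h h' => simp only [map_add, h, h']; module
      | smul c X h => simp only [map_smul, h]; module
      | z ha => simp [KM.bracket_z_right]
      | u hc => simp [KM.bracket_u_u, KM.bracket_loop_u, KM.bracket_u_loop, koszul_zero_right]
      | loop k w hw =>
        simp only [KM.bracket_loop_u, KM.bracket_u_loop, koszul_zero_right, map_smul, map_neg,
          KM.bracket_loop_loop, map_add, LinearMap.neg_apply, LinearMap.smul_apply,
          KM.bracket_z_right, smul_zero, add_zero]
        by_cases h : m = -k
        · rw [if_pos h]; subst h; push_cast; module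
        · rw [if_neg h]; push_cast; module
    | loop n y hy =>
      induction hZ using KM.part_induction with
      | zero => simp
      | add X X' h h' => simp only [map_add, h, h']; module
      | smul c X h => simp only [map_smul, h]; module
      | z ha => simp [KM.bracket_z_right]
      | u hc =>
        have hs : br x y = -(koszul a b • br y x) := br_skew hx hy
        have hf : F.form x y = koszul a b * F.form y x := F.supersymm hx hy
        simp only [KM.bracket_loop_u, map_smul, map_neg,
          KM.bracket_loop_loop, map_add, LinearMap.add_apply, LinearMap.smul_apply,
          LinearMap.neg_apply, KM.bracket_z_left, smul_zero, add_zero, hs, hf, add_comm n m]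
        by_cases h : m = -n
        · have h' : n = -m := by omega
          rw [if_pos h, if_pos h', h]; push_cast; module
        · have h' : n ≠ -m := by omega
          rw [if_neg h, if_neg h']; push_cast; module
      | loop k w hw => exact KM.bracket_jacobi_loop hx hy hw m n k
  | u ha =>
    subst ha
    induction hY using KM.part_induction with
    | zero => simp
    | add X X' h h' => simp only [map_add, LinearMap.add_apply, h, h']; module
    | smul c X h => simp only [map_smul, LinearMap.smul_apply, h]; module
    | z ha => simp [KM.bracket_z_left, KM.bracket_z_right]
    | u hb => simp [KM.bracket_u_u, koszul_zero_left]
    | loop n y hy =>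
      induction hZ using KM.part_induction with
      | zero => simp
      | add X X' h h' => simp only [map_add, h, h']; module
      | smul c X h => simp only [map_smul, h]; module
      | z ha => simp [KM.bracket_z_right]
      | u hc => simp [KM.bracket_u_u, KM.bracket_loop_u, KM.bracket_u_loop]
      | loop k w hw =>
        simp only [KM.bracket_u_loop, koszul_zero_left, map_smul,
          KM.bracket_loop_loop, map_add, LinearMap.smul_apply,
          KM.bracket_z_right, smul_zero, add_zero]
        by_cases h : n = -k
        · rw [if_pos h]; subst h; push_cast; module
        · rw [if_neg h]; push_cast; module

/-- The Kac–Moody superalgebra `ĝ`. -/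
instance KM.instLieSuperalgebra : LieSuperalgebra (KM F) where
  part := KM.part F
  isCompl := KM.isCompl_part
  br := KM.bracket F
  br_mem := KM.bracket_mem
  br_skew := KM.bracket_skew
  jacobi := KM.bracket_jacobi

/-! ### The completed enveloping algebra -/

variable (F)

/-- The left ideal `U(ĝ) · t^N g[t]`. -/
def leftIdeal (N : ℕ) : Ideal (Env (KM F)) :=
  Ideal.span {w | ∃ n : ℤ, (N : ℤ) ≤ n ∧ ∃ x : g, w = Env.inc (KM F) (KM.loop F n x)}

variable {F}

theorem loop_mem_leftIdeal {N : ℕ} {n : ℤ} (h : (N : ℤ) ≤ n) (x : g) :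
    Env.inc (KM F) (KM.loop F n x) ∈ leftIdeal F N :=
  Ideal.subset_span ⟨n, h, x, rfl⟩

theorem leftIdeal_anti {M N : ℕ} (h : N ≤ M) : leftIdeal F M ≤ leftIdeal F N := by
  refine Ideal.span_le.2 ?_
  rintro _ ⟨n, hn, x, rfl⟩
  exact loop_mem_leftIdeal (by omega) x

/-- It suffices to test right multiplication on homogeneous generators. -/
theorem mul_mem_of_gen {M N : ℕ} {b : Env (KM F)}
    (h : ∀ n : ℤ, (M : ℤ) ≤ n → ∀ a, ∀ x ∈ LieSuperalgebra.part (L := g) a,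
      Env.inc (KM F) (KM.loop F n x) * b ∈ leftIdeal F N) :
    ∀ w ∈ leftIdeal F M, w * b ∈ leftIdeal F N := by
  intro w hw
  refine Submodule.span_induction (p := fun w _ => w * b ∈ leftIdeal F N) ?_ ?_ ?_ ?_ hw
  · rintro _ ⟨n, hn, x, rfl⟩
    obtain ⟨y, hy, v, hv, rfl⟩ := exists_add_part x
    rw [map_add, map_add, add_mul]
    exact add_mem (h n hn 0 y hy) (h n hn 1 v hv)
  · simp
  · intro x y _ _ hx hy
    rw [add_mul]; exact add_mem hx hy
  · intro c x _ hx
    rw [smul_eq_mul, mul_assoc]; exact Ideal.mul_mem_left _ _ hx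

theorem exists_mul_mem_homogeneous {b : ZMod 2} {Y : KM F} (hY : Y ∈ KM.part F b) (N : ℕ) :
    ∃ M : ℕ, ∀ w ∈ leftIdeal F M, w * Env.inc (KM F) Y ∈ leftIdeal F N := by
  have smulmem : ∀ (c : ℂ) (w : Env (KM F)), w ∈ leftIdeal F N → c • w ∈ leftIdeal F N := by
    intro c w hw
    rw [Algebra.smul_def]; exact Ideal.mul_mem_left _ _ hw
  induction hY using KM.part_induction with
  | zero => exact ⟨0, fun w _ => by simp⟩
  | add X Y hX hY =>
    obtain ⟨M, hM⟩ := hX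
    obtain ⟨M', hM'⟩ := hY
    refine ⟨max M M', fun w hw => ?_⟩
    rw [map_add, mul_add]
    exact add_mem (hM w (leftIdeal_anti (le_max_left _ _) hw))
      (hM' w (leftIdeal_anti (le_max_right _ _) hw))
  | smul c X hX =>
    obtain ⟨M, hM⟩ := hX
    refine ⟨M, fun w hw => ?_⟩
    rw [map_smul, mul_smul_comm]
    exact smulmem _ _ (hM w hw)
  | loop m y hy =>
    refine ⟨N + m.natAbs + 1, mul_mem_of_gen fun n hn a x hx => ?_⟩
    rw [Env.inc_mul (show KM.loop F n x ∈ LieSuperalgebra.part a from KM.loop_mem_part n hx)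
      (show KM.loop F m y ∈ LieSuperalgebra.part b from KM.loop_mem_part m hy)]
    refine add_mem (smulmem _ _ (Ideal.mul_mem_left _ _ (loop_mem_leftIdeal (by omega) x))) ?_
    rw [show LieSuperalgebra.br (KM.loop F n x) (KM.loop F m y)
        = KM.bracket F (KM.loop F n x) (KM.loop F m y) from rfl, KM.bracket_loop_loop,
      if_neg (by omega), zero_smul, add_zero]
    exact loop_mem_leftIdeal (by omega) _
  | u hb =>
    refine ⟨N, mul_mem_of_gen fun n hn a x hx => ?_⟩
    rw [Env.inc_mul (show KM.loop F n x ∈ LieSuperalgebra.part a from KM.loop_mem_part n hx)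
      (show KM.u F ∈ LieSuperalgebra.part 0 from KM.u_mem_part)]
    refine add_mem (smulmem _ _ (Ideal.mul_mem_left _ _ (loop_mem_leftIdeal (by omega) x))) ?_
    rw [show LieSuperalgebra.br (KM.loop F n x) (KM.u F)
        = KM.bracket F (KM.loop F n x) (KM.u F) from rfl, KM.bracket_loop_u, map_neg, map_smul]
    exact neg_mem (smulmem _ _ (loop_mem_leftIdeal (by omega) _))
  | z hb =>
    refine ⟨N, mul_mem_of_gen fun n hn a x hx => ?_⟩
    rw [Env.inc_mul (show KM.loop F n x ∈ LieSuperalgebra.part a from KM.loop_mem_part n hx)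
      (show KM.z F ∈ LieSuperalgebra.part 0 from KM.z_mem_part)]
    refine add_mem (smulmem _ _ (Ideal.mul_mem_left _ _ (loop_mem_leftIdeal (by omega) x))) ?_
    rw [show LieSuperalgebra.br (KM.loop F n x) (KM.z F)
        = KM.bracket F (KM.loop F n x) (KM.z F) from rfl, KM.bracket_z_right, map_zero]
    exact zero_mem _

/-- Right multiplication is continuous for the topology given by the left ideals. -/
theorem exists_mul_mem (b : Env (KM F)) :
    ∀ N : ℕ, ∃ M : ℕ, ∀ w ∈ leftIdeal F M, w * b ∈ leftIdeal F N := by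
  induction b using Env.induction with
  | hc r =>
    refine fun N => ⟨N, fun w hw => ?_⟩
    rw [← Algebra.commutes]
    exact Ideal.mul_mem_left _ _ hw
  | hi Y =>
    intro N
    obtain ⟨y, hy, v, hv, rfl⟩ := exists_add_part Y
    obtain ⟨M, hM⟩ := exists_mul_mem_homogeneous hy N
    obtain ⟨M', hM'⟩ := exists_mul_mem_homogeneous hv N
    refine ⟨max M M', fun w hw => ?_⟩
    rw [map_add, mul_add]
    exact add_mem (hM w (leftIdeal_anti (le_max_left _ _) hw))
      (hM' w (leftIdeal_anti (le_max_right _ _) hw))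
  | hm x y hx hy =>
    intro N
    obtain ⟨M, hM⟩ := hy N
    obtain ⟨M', hM'⟩ := hx M
    refine ⟨M', fun w hw => ?_⟩
    rw [← mul_assoc]
    exact hM _ (hM' w hw)
  | ha x y hx hy =>
    intro N
    obtain ⟨M, hM⟩ := hx N
    obtain ⟨M', hM'⟩ := hy N
    refine ⟨max M M', fun w hw => ?_⟩
    rw [mul_add]
    exact add_mem (hM w (leftIdeal_anti (le_max_left _ _) hw))
      (hM' w (leftIdeal_anti (le_max_right _ _) hw))

variable (F)

theorem leftIdeal_basis :
    RingSubgroupsBasis fun N : ℕ => (leftIdeal F N).toAddSubgroup where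
  inter i j := ⟨max i j, le_inf (leftIdeal_anti (le_max_left _ _))
    (leftIdeal_anti (le_max_right _ _))⟩
  mul i := ⟨i, by
    rintro _ ⟨x, _, y, hy, rfl⟩
    exact Ideal.mul_mem_left _ _ hy⟩
  leftMul x i := ⟨i, fun y hy => Ideal.mul_mem_left _ _ hy⟩
  rightMul x i := by
    obtain ⟨M, hM⟩ := exists_mul_mem x i
    exact ⟨M, fun y hy => hM y hy⟩

/-- The topology on `U(ĝ)` in which the left ideals `U(ĝ) · t^N g[t]`, `N ≥ 0`, form a
neighbourhood basis of zero. -/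
instance : TopologicalSpace (Env (KM F)) := (leftIdeal_basis F).topology

instance : IsTopologicalRing (Env (KM F)) :=
  (leftIdeal_basis F).toRingFilterBasis.isTopologicalRing

instance : UniformSpace (Env (KM F)) := IsTopologicalAddGroup.rightUniformSpace _

instance : IsUniformAddGroup (Env (KM F)) := isUniformAddGroup_of_addCommGroup

/-- The completed enveloping algebra `Û(ĝ) = lim U(ĝ) / U(ĝ) · t^N g[t]`; it is a complete
Hausdorff topological ring, with the ring structure extending that of `U(ĝ)` by continuity. -/
abbrev EnvHat : Type _ := UniformSpace.Completion (Env (KM F))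

/-- The canonical map `U(ĝ) → Û(ĝ)`. -/
def toHat : Env (KM F) →+* EnvHat F := UniformSpace.Completion.coeRingHom

/-- The canonical map `ĝ → U(ĝ)`. -/
abbrev gen (X : KM F) : Env (KM F) := Env.inc (KM F) X

/-! ### The Casimir elements -/

variable {ι : Type*} [Fintype ι] [DecidableEq ι]

/-- The matrix `(b_ij)` inverse to the Gram matrix `a_ij = (e_i | e_j)`. -/
def dualGram (e : Module.Basis ι ℂ g) : Matrix ι ι ℂ :=
  (Matrix.of fun i j => F.form (e i) (e j))⁻¹

/-- The operator `A(x) = ∑ b_ij [[x, e_i], e_j]`. -/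
def opA (e : Module.Basis ι ℂ g) (x : g) : g :=
  ∑ i, ∑ j, dualGram F e i j • br (br x (e i)) (e j)

/-- `∑ b_ij t⁻ⁿ e_i ⊗ tⁿ e_j`. -/
def casimirTerm (e : Module.Basis ι ℂ g) (n : ℤ) : Env (KM F) :=
  ∑ i, ∑ j, dualGram F e i j • (gen F (KM.loop F (-n) (e i)) * gen F (KM.loop F n (e j)))

/-- `Ω₀ = ∑ b_ij e_i ⊗ e_j`. -/
def casimirZero (e : Module.Basis ι ℂ g) : EnvHat F := toHat F (casimirTerm F e 0)

/-- `Ω^{pm} = ∑_{n ≥ 1} ∑ b_ij t⁻ⁿ e_i ⊗ tⁿ e_j`. -/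
def casimirPM (e : Module.Basis ι ℂ g) : EnvHat F :=
  ∑' n : ℕ, toHat F (casimirTerm F e (n + 1))

/-- `Ω = Ω₀ + 2 Ω^{pm} + 2 u ⊗ z + lam u`. -/
def casimir (e : Module.Basis ι ℂ g) (lam : ℂ) : EnvHat F :=
  casimirZero F e + 2 * casimirPM F e
    + toHat F ((2 : ℂ) • (gen F (KM.u F) * gen F (KM.z F)) + lam • gen F (KM.u F))

end KM

/-! ### Wick normal forms -/

/-- Indices for the basis `tⁿ e_i`, `u`, `z` of `ĝ`. -/
inductive KMIndex (ι : Type*)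
  | loop (n : ℤ) (i : ι)
  | u
  | z

/-- The degree with respect to `u`, i.e. the eigenvalue of `ad u`. -/
def KMIndex.deg {ι : Type*} : KMIndex ι → ℤ
  | .loop n _ => n
  | .u => 0
  | .z => 0

/-- The basis vector of `ĝ` with the given index. -/
def KMIndex.vec {g : Type*} [AddCommGroup g] [Module ℂ g] [LieSuperalgebra g]
    (F : InvariantForm g) {ι : Type*} (e : Module.Basis ι ℂ g) : KMIndex ι → KM F
  | .loop n i => KM.loop F n (e i)
  | .u => KM.u F
  | .z => KM.z F

/-- An ordering convention for products `e_i ⊗ e_j` of two basis elements of `g`, of parities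
`p i` and `p j`; `r i j` means that `e_i` may stand to the left of `e_j`. Out of two distinct basis
elements at least one of the two orders must be allowed, and squares of even basis elements are
allowed. The trivially true `r` imposes no condition beyond the one on degrees, a linear order
on the basis gives Poincaré–Birkhoff–Witt monomials, and a triangular decomposition of `g` gives
the order lowering, Cartan, raising. -/
structure IsOrderingRule {ι : Type*} (p : ι → ZMod 2) (r : ι → ι → Prop) : Prop where
  total : ∀ i j, i ≠ j → r i j ∨ r j i
  sq : ∀ i, p i = 0 → r i i

/-- The tensor product `X ⊗ Y` is normally ordered: the first factor has non-positive degree and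
the second one has non-negative degree with respect to `u`, and two factors that both lie in `g`
are ordered by the rule `r`. -/
def IsNormalOrdered {ι : Type*} (r : ι → ι → Prop) (X Y : KMIndex ι) : Prop :=
  X.deg ≤ 0 ∧ 0 ≤ Y.deg ∧ ∀ i j, X = .loop 0 i → Y = .loop 0 j → r i j

section Wick

variable {g : Type*} [AddCommGroup g] [Module ℂ g] [LieSuperalgebra g] (F : InvariantForm g)
  {ι : Type*} (e : Module.Basis ι ℂ g) (r : ι → ι → Prop)

/-- `w = ∑ c_{XY} X ⊗ Y + l` is a Wick normal form of `w ∈ Û(ĝ)`: a convergent, possibly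
infinite, sum of normally ordered quadratic terms plus a linear term `l ∈ ĝ`. -/
structure IsWickNormalForm (w : EnvHat F) (c : KMIndex ι → KMIndex ι → ℂ) (l : KM F) : Prop where
  ordered : ∀ X Y, c X Y ≠ 0 → IsNormalOrdered r X Y
  hasSum : HasSum (fun q : KMIndex ι × KMIndex ι =>
    toHat F (c q.1 q.2 • (gen F (q.1.vec F e) * gen F (q.2.vec F e)))) (w - toHat F (gen F l))

/-- `l` is the linear term of a Wick normal form of `w`. -/
def IsWickLinearTerm (w : EnvHat F) (l : KM F) : Prop :=
  ∃ c : KMIndex ι → KMIndex ι → ℂ, IsWickNormalForm F e r w c l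

end Wick

end KacMoodySuper

end

noncomputable section

namespace KacMoodySuper

open LieSuperalgebra Filter Topology

/-! Centrality. Let `X = tᵐ x` and `Ω_n = ∑ b_ij t⁻ⁿ e_i ⊗ tⁿ e_j`. Invariance of the tensor `∑ b_ij
e_i ⊗ e_j` gives `[X, Ω_n] = D n - D (n + m)` plus a multiple of `X ⊗ z`, where `D n = ∑ b_ij tᵐ⁻ⁿ
[x, e_i] ⊗ tⁿ e_j` (`loop_commutator_casimirTerm`). In `[X, Ω₀ + 2 ∑_{n ≥ 1} Ω_n]` the `D`-terms
telescope to about `|m|` terms near the origin, because `D n` tends to zero as `n` grows.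

For `m ≠ 0` the reflection `n ↦ m - n` exchanges the two tensor factors up to the Koszul sign, so
supercommuting them yields `D n + D (m - n) = tᵐ A(x) = lam X` (`adTerm_add_adTerm`). The surviving
terms pair up to `m lam X` (`telescope_mem`), which cancels against `[X, lam u]`; the cocycle terms
sum to `2 m X ⊗ z`, which cancels against `[X, 2 u ⊗ z]`. All this is done for the partial sums
modulo the left ideals, and then a limit is taken. Density of `U(ĝ)` reduces centrality to
commutation with generators.

Linear terms. `Ω - Ω₀` is visibly in Wick normal form with linear term `lam u`, whatever the rule,
so adding or subtracting it gives the equivalence. The `u`-coefficient of a linear term is unique: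
no bracket in `ĝ` has a `u`-component, so `X ↦ X.uCoeff ε` extends to `U(ĝ) → ℂ[ε]`, which kills all
quadratic terms and all the left ideals (`uCoeff_eq_zero_of_hasSum`). -/

theorem koszul_comm (a b : ZMod 2) : koszul a b = koszul b a := by
  simp only [koszul, and_comm]

theorem koszul_mul_self (a b : ZMod 2) : koszul a b * koszul a b = 1 := by
  unfold koszul; split_ifs <;> norm_num

theorem koszul_add_right (a b c : ZMod 2) : koszul a (b + c) = koszul a b * koszul a c := by
  have hz : ∀ a : ZMod 2, a = 0 ∨ a = 1 := by decide
  have h2 : (1 + 1 : ZMod 2) = 0 := rfl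
  rcases hz a with rfl | rfl <;> rcases hz b with rfl | rfl <;> rcases hz c with rfl | rfl <;>
    simp [koszul, h2]

/-! ### The dual Gram matrix: parity, symmetry, invariance. -/

section Gram

variable {g : Type*} [AddCommGroup g] [Module ℂ g] [LieSuperalgebra g] (F : InvariantForm g)
  {ι : Type*} [Fintype ι] [DecidableEq ι] (e : Module.Basis ι ℂ g)

/-- The Gram matrix of the form in the basis `e`. -/
def gram : Matrix ι ι ℂ := Matrix.of fun i j => F.form (e i) (e j)

omit [Fintype ι] [DecidableEq ι] in
theorem gram_apply (i j : ι) : gram F e i j = F.form (e i) (e j) := rfl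

theorem isUnit_det_gram : IsUnit (gram F e).det := by
  have h := (LinearMap.nondegenerate_iff_det_ne_zero (B := F.form) e).1 F.nondegenerate
  have h' : LinearMap.toMatrix₂ e e F.form = gram F e := by
    ext i j; simp [gram, LinearMap.toMatrix₂_apply]
  rw [h'] at h
  exact isUnit_iff_ne_zero.2 h

theorem gram_mul_dualGram : gram F e * dualGram F e = 1 :=
  Matrix.mul_nonsing_inv _ (isUnit_det_gram F e)

theorem dualGram_mul_gram : dualGram F e * gram F e = 1 :=
  Matrix.nonsing_inv_mul _ (isUnit_det_gram F e)

theorem eq_dualGram {B : Matrix ι ι ℂ} (h : gram F e * B = 1) : B = dualGram F e := by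
  have := congrArg (dualGram F e * ·) h
  simpa [← Matrix.mul_assoc, dualGram_mul_gram] using this

/-- Expansion in dual bases. This and `sum_dualGram_form_right` turn the cocycle terms of the
commutator back into multiples of `x`. -/
theorem sum_dualGram_form_left (x : g) :
    ∑ i, ∑ j, (dualGram F e i j * F.form x (e i)) • e j = x := by
  have key : ∀ k, ∑ i, ∑ j, (dualGram F e i j * F.form (e k) (e i)) • e j = e k := by
    intro k
    rw [Finset.sum_comm]
    have h : ∀ j, ∑ i, (dualGram F e i j * F.form (e k) (e i)) • e j
        = (1 : Matrix ι ι ℂ) k j • e j := by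
      intro j
      rw [← gram_mul_dualGram F e, Matrix.mul_apply, Finset.sum_smul]
      exact Finset.sum_congr rfl fun i _ => by rw [gram_apply, mul_comm]
    simp [h, Matrix.one_apply]
  have : (∑ i, ∑ j, dualGram F e i j • (LinearMap.toSpanSingleton ℂ g (e j)) ∘ₗ F.form.flip (e i))
      = LinearMap.id := by
    refine e.ext fun k => ?_
    simpa [LinearMap.sum_apply, mul_smul] using key k
  simpa [LinearMap.sum_apply, mul_smul] using congrArg (fun f => f x) this

theorem sum_dualGram_form_right (x : g) :
    ∑ i, ∑ j, (dualGram F e i j * F.form (e j) x) • e i = x := by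
  have key : ∀ k, ∑ i, ∑ j, (dualGram F e i j * F.form (e j) (e k)) • e i = e k := by
    intro k
    have h : ∀ i, ∑ j, (dualGram F e i j * F.form (e j) (e k)) • e i
        = (1 : Matrix ι ι ℂ) i k • e i := by
      intro i
      rw [← dualGram_mul_gram F e, Matrix.mul_apply, Finset.sum_smul]
      rfl
    simp [h, Matrix.one_apply]
  have : (∑ i, ∑ j, dualGram F e i j • (LinearMap.toSpanSingleton ℂ g (e i)) ∘ₗ F.form (e j))
      = LinearMap.id := by
    refine e.ext fun k => ?_
    simpa [LinearMap.sum_apply, mul_smul] using key k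
  simpa [LinearMap.sum_apply, mul_smul] using congrArg (fun f => f x) this

variable {e} {p : ι → ZMod 2} (he : ∀ i, e i ∈ LieSuperalgebra.part (L := g) (p i))
include he

omit [Fintype ι] [DecidableEq ι] in
theorem gram_eq_zero {i j : ι} (h : p i ≠ p j) : gram F e i j = 0 :=
  F.even h (he i) (he j)

/-- Since the form is even, discarding the entries between different parities leaves a right inverse
of the Gram matrix, and the inverse is unique. -/
theorem dualGram_eq_zero {i j : ι} (h : p i ≠ p j) : dualGram F e i j = 0 := by
  have key : (Matrix.of fun i j => if p i = p j then dualGram F e i j else 0) = dualGram F e := by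
    refine eq_dualGram F e ?_
    ext i k
    rw [Matrix.mul_apply]
    by_cases hik : p i = p k
    · rw [← gram_mul_dualGram F e, Matrix.mul_apply]
      refine Finset.sum_congr rfl fun j _ => ?_
      by_cases hj : p i = p j
      · simp [← hik, ← hj]
      · simp [gram_eq_zero F he hj]
    · rw [Matrix.one_apply_ne (fun t => hik (congrArg p t))]
      refine Finset.sum_eq_zero fun j _ => ?_
      by_cases hj : p i = p j
      · simp [← hj, hik]
      · simp [gram_eq_zero F he hj]
  rw [← key]
  simp [h]

/-- By supersymmetry of the form, the sign-twisted transpose of the inverse is again a right inverse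
of the Gram matrix. -/
theorem dualGram_swap (i j : ι) : dualGram F e j i = koszul (p i) (p j) * dualGram F e i j := by
  have key : (Matrix.of fun i j => koszul (p i) (p j) * dualGram F e j i) = dualGram F e := by
    refine eq_dualGram F e ?_
    ext i k
    rw [← Matrix.transpose_one, ← dualGram_mul_gram F e, Matrix.transpose_apply, Matrix.mul_apply,
      Matrix.mul_apply]
    refine Finset.sum_congr rfl fun j _ => ?_
    rw [Matrix.of_apply]
    by_cases hij : p i = p j
    · by_cases hjk : p k = p j
      · rw [gram_apply, gram_apply, F.supersymm (he i) (he j), hjk, hij]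
        linear_combination dualGram F e k j * F.form (e j) (e i) * koszul_mul_self (p j) (p j)
      · simp [dualGram_eq_zero F he hjk]
    · simp [gram_eq_zero F he hij, gram_eq_zero F he (Ne.symm hij)]
  have h := congrFun (congrFun key j) i
  rw [← h, koszul_comm]; rfl

omit [Fintype ι] [DecidableEq ι] in
theorem form_br_eq {a : ZMod 2} {x : g} (hx : x ∈ LieSuperalgebra.part (L := g) a) (i : ι) (y : g) :
    F.form (br x (e i)) y = -(koszul a (p i) * F.form (e i) (br x y)) := by
  rw [br_skew hx (he i), map_neg, map_smul, LinearMap.neg_apply, LinearMap.smul_apply,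
    F.invariant, smul_eq_mul]

/-- The tensor `∑ b_ij e_i ⊗ e_j` is invariant under the adjoint action. -/
theorem sum_dualGram_invariant {a : ZMod 2} {x : g} (hx : x ∈ LieSuperalgebra.part (L := g) a)
    {V : Type*} [AddCommGroup V] [Module ℂ V] (Φ : g →ₗ[ℂ] g →ₗ[ℂ] V) :
    ∑ i, ∑ j, dualGram F e i j • (koszul a (p i) • Φ (e i) (br x (e j)))
      = -∑ i, ∑ j, dualGram F e i j • Φ (br x (e i)) (e j) := by
  set M := LinearMap.toMatrix e e (br x) with hM
  set K : Matrix ι ι ℂ := Matrix.diagonal fun i => koszul a (p i) with hK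
  have hbr : ∀ i, br x (e i) = ∑ k, M k i • e k := fun i => by
    simp only [hM, LinearMap.toMatrix_apply]
    exact (e.sum_repr _).symm
  -- Invariance of the form in terms of the matrix `M` of `ad x`. The sign matrix `K` commutes with
  -- the Gram matrix because the form is even, so multiplying by the inverse on both sides carries
  -- the identity over to the dual matrix; there `K * K = 1` absorbs the Koszul signs.
  have h1 : M.transpose * gram F e = -(K * gram F e * M) := by
    ext i k
    have := form_br_eq F he hx i (e k)
    rw [hbr i, hbr k] at this
    simp only [map_sum, map_smul, LinearMap.sum_apply, LinearMap.smul_apply, smul_eq_mul] at this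
    rw [Matrix.mul_apply, Matrix.neg_apply, Matrix.mul_assoc, hK, Matrix.diagonal_mul,
      Matrix.mul_apply]
    simpa [gram_apply, mul_comm] using this
  have h2 : K * gram F e = gram F e * K := by
    ext i k
    rw [hK, Matrix.diagonal_mul, Matrix.mul_diagonal]
    by_cases h : p i = p k
    · rw [h, mul_comm]
    · simp [gram_eq_zero F he h]
  have h3 : dualGram F e * M.transpose = -(K * M * dualGram F e) := by
    calc dualGram F e * M.transpose
        = dualGram F e * (M.transpose * gram F e) * dualGram F e := by
          rw [Matrix.mul_assoc, Matrix.mul_assoc, gram_mul_dualGram, Matrix.mul_one]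
      _ = -((dualGram F e * gram F e) * K * M * dualGram F e) := by
          rw [h1, h2]; simp only [Matrix.mul_neg, Matrix.neg_mul, Matrix.mul_assoc]
      _ = _ := by rw [dualGram_mul_gram, Matrix.one_mul]
  have hL : ∑ i, ∑ j, dualGram F e i j • (koszul a (p i) • Φ (e i) (br x (e j)))
      = ∑ i, ∑ k, (koszul a (p i) * (dualGram F e * M.transpose) i k) • Φ (e i) (e k) := by
    refine Finset.sum_congr rfl fun i _ => ?_
    simp only [hbr, map_sum, map_smul, Finset.smul_sum]
    rw [Finset.sum_comm]
    refine Finset.sum_congr rfl fun k _ => ?_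
    rw [Matrix.mul_apply, Finset.mul_sum, Finset.sum_smul]
    refine Finset.sum_congr rfl fun j _ => ?_
    rw [smul_smul, smul_smul, Matrix.transpose_apply]
    congr 1; ring
  have hR : ∑ i, ∑ j, dualGram F e i j • Φ (br x (e i)) (e j)
      = ∑ k, ∑ j, (M * dualGram F e) k j • Φ (e k) (e j) := by
    simp only [hbr, map_sum, map_smul, LinearMap.sum_apply, LinearMap.smul_apply, Finset.smul_sum,
      Matrix.mul_apply, Finset.sum_smul]
    rw [Finset.sum_congr rfl fun i _ => Finset.sum_comm, Finset.sum_comm]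
    refine Finset.sum_congr rfl fun k _ => ?_
    rw [Finset.sum_comm]
    refine Finset.sum_congr rfl fun j _ => Finset.sum_congr rfl fun i _ => ?_
    rw [smul_smul, mul_comm]
  rw [hL, hR, ← Finset.sum_neg_distrib]
  refine Finset.sum_congr rfl fun i _ => ?_
  rw [← Finset.sum_neg_distrib]
  refine Finset.sum_congr rfl fun k _ => ?_
  rw [h3, Matrix.neg_apply, hK, Matrix.mul_assoc, Matrix.diagonal_mul, ← neg_smul]
  congr 1
  linear_combination -(M * dualGram F e) i k * koszul_mul_self a (p i)

end Gram

/-! ### Commutators of loops with the terms of the Casimir element. -/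

section Commutators

/-- The factors `y` and `w` have equal parity, so carrying `x` past both produces a squared sign: an
ordinary commutator with an even element results. -/
theorem Env.inc_mul_mul_sub {L : Type*} [AddCommGroup L] [Module ℂ L] [LieSuperalgebra L]
    {a b : ZMod 2} {x y w : L} (hx : x ∈ part a) (hy : y ∈ part b) (hw : w ∈ part b) :
    Env.inc L x * (Env.inc L y * Env.inc L w) - Env.inc L y * Env.inc L w * Env.inc L x
      = Env.inc L (br x y) * Env.inc L w + koszul a b • (Env.inc L y * Env.inc L (br x w)) := by
  rw [← mul_assoc, Env.inc_mul hx hy, add_mul, smul_mul_assoc, mul_assoc, Env.inc_mul hx hw,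
    mul_add, smul_add, mul_smul_comm, smul_smul, koszul_mul_self, one_smul, ← mul_assoc]
  abel

variable {g : Type*} [AddCommGroup g] [Module ℂ g] [LieSuperalgebra g] {F : InvariantForm g}

theorem br_loop_loop (m n : ℤ) (x y : g) :
    br (KM.loop F m x) (KM.loop F n y) = KM.loop F (m + n) (br x y)
      + (if m = -n then (m : ℂ) else 0) • F.form x y • KM.z F :=
  KM.bracket_loop_loop m n x y

theorem gen_add (X Y : KM F) : gen F (X + Y) = gen F X + gen F Y := map_add _ X Y

theorem gen_smul (c : ℂ) (X : KM F) : gen F (c • X) = c • gen F X := map_smul _ c X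

theorem gen_z_comm (X : KM F) : gen F (KM.z F) * gen F X = gen F X * gen F (KM.z F) := by
  obtain ⟨y, hy, v, hv, rfl⟩ := exists_add_part X
  have hz : ∀ (b : ZMod 2) (y : KM F), y ∈ part b →
      gen F (KM.z F) * gen F y = gen F y * gen F (KM.z F) := by
    intro b y hy
    have h := Env.inc_mul (show KM.z F ∈ part 0 from KM.z_mem_part) hy
    rw [koszul_zero_left, one_smul,
      show br (KM.z F) y = 0 from KM.bracket_z_left y, map_zero, add_zero] at h
    exact h
  rw [gen_add, mul_add, add_mul, hz 0 y hy, hz 1 v hv]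

theorem gen_u_loop (n : ℤ) (x : g) :
    gen F (KM.u F) * gen F (KM.loop F n x) - gen F (KM.loop F n x) * gen F (KM.u F)
      = (n : ℂ) • gen F (KM.loop F n x) := by
  have hz : ∀ (b : ZMod 2) (y : g), y ∈ LieSuperalgebra.part (L := g) b →
      gen F (KM.u F) * gen F (KM.loop F n y) - gen F (KM.loop F n y) * gen F (KM.u F)
      = (n : ℂ) • gen F (KM.loop F n y) := by
    intro b y hy
    have h := Env.inc_mul (show KM.u F ∈ part 0 from KM.u_mem_part)
      (show KM.loop F n y ∈ part b from KM.loop_mem_part n hy)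
    rw [koszul_zero_left, one_smul,
      show br (KM.u F) (KM.loop F n y) = (n : ℂ) • KM.loop F n y from KM.bracket_u_loop n y,
      map_smul] at h
    rw [sub_eq_iff_eq_add, add_comm]
    exact h
  obtain ⟨y, hy, v, hv, rfl⟩ := exists_add_part x
  rw [map_add, gen_add, mul_add, add_mul, smul_add, ← hz 0 y hy, ← hz 1 v hv]
  abel

variable (F)

/-- The bilinear map `(x, y) ↦ tᵏ x ⊗ tˡ y`. -/
def loopMul (k l : ℤ) : g →ₗ[ℂ] g →ₗ[ℂ] Env (KM F) :=
  (LinearMap.mul ℂ (Env (KM F))).compl₁₂ (Env.inc (KM F) ∘ₗ KM.loop F k)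
    (Env.inc (KM F) ∘ₗ KM.loop F l)

theorem loopMul_apply (k l : ℤ) (x y : g) :
    loopMul F k l x y = gen F (KM.loop F k x) * gen F (KM.loop F l y) := rfl

variable {ι : Type*} [Fintype ι] [DecidableEq ι] (e : Module.Basis ι ℂ g)

/-- `∑ b_ij tᵏ [x, e_i] ⊗ tˡ e_j`. -/
def adTerm (x : g) (k l : ℤ) : Env (KM F) :=
  ∑ i, ∑ j, dualGram F e i j • loopMul F k l (br x (e i)) (e j)

variable {F e} {p : ι → ZMod 2} (he : ∀ i, e i ∈ LieSuperalgebra.part (L := g) (p i))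
include he

/-- The super Leibniz rule gives two quadratic sums; `sum_dualGram_invariant` moves `ad x` from the
second factor to the first, so both become `adTerm`s. The Kronecker symbols come from the cocycle.
-/
theorem loop_commutator_casimirTerm {a : ZMod 2} {x : g}
    (hx : x ∈ LieSuperalgebra.part (L := g) a) (m n : ℤ) :
    gen F (KM.loop F m x) * casimirTerm F e n - casimirTerm F e n * gen F (KM.loop F m x)
      = adTerm F e x (m - n) n - adTerm F e x (-n) (m + n)
        + ((if m = n then (m : ℂ) else 0) + (if m = -n then (m : ℂ) else 0)) •
          (gen F (KM.loop F m x) * gen F (KM.z F)) := by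
  have h1 : ∀ i j, dualGram F e i j •
      (gen F (KM.loop F m x) * (gen F (KM.loop F (-n) (e i)) * gen F (KM.loop F n (e j)))
        - gen F (KM.loop F (-n) (e i)) * gen F (KM.loop F n (e j)) * gen F (KM.loop F m x))
      = dualGram F e i j • loopMul F (m - n) n (br x (e i)) (e j)
        + dualGram F e i j • (koszul a (p i) • loopMul F (-n) (m + n) (e i) (br x (e j)))
        + (if m = n then (m : ℂ) else 0) • (gen F (KM.loop F n
            ((dualGram F e i j * F.form x (e i)) • e j)) * gen F (KM.z F))
        + (if m = -n then (m : ℂ) else 0) • (gen F (KM.loop F (-n)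
            ((dualGram F e i j * F.form (e j) x) • e i)) * gen F (KM.z F)) := by
    intro i j
    -- The Leibniz rule requires equal parities of `e i` and `e j`; otherwise the coefficient
    -- vanishes.
    by_cases hij : p i = p j
    · have hs : koszul a (p i) * F.form x (e j) = F.form (e j) x := by
        rw [hij, F.supersymm hx (he j), ← mul_assoc, koszul_mul_self, one_mul]
      rw [Env.inc_mul_mul_sub (show KM.loop F m x ∈ part a from KM.loop_mem_part m hx)
        (show KM.loop F (-n) (e i) ∈ part (p i) from KM.loop_mem_part _ (he i))
        (show KM.loop F n (e j) ∈ part (p i) from KM.loop_mem_part _ (hij ▸ he j)),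
        br_loop_loop, br_loop_loop, neg_neg, ← hs, loopMul_apply, loopMul_apply, ← sub_eq_add_neg]
      simp only [map_add, map_smul, add_mul, mul_add, smul_add, smul_mul_assoc, mul_smul_comm,
        gen_z_comm]
      module
    · simp [dualGram_eq_zero F he hij]
  have hl : gen F (KM.loop F m x) * casimirTerm F e n
      - casimirTerm F e n * gen F (KM.loop F m x)
      = ∑ i, ∑ j, dualGram F e i j •
      (gen F (KM.loop F m x) * (gen F (KM.loop F (-n) (e i)) * gen F (KM.loop F n (e j)))
        - gen F (KM.loop F (-n) (e i)) * gen F (KM.loop F n (e j)) * gen F (KM.loop F m x)) := by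
    simp only [casimirTerm, Finset.mul_sum, Finset.sum_mul, ← Finset.sum_sub_distrib,
      smul_sub, mul_smul_comm, smul_mul_assoc]
  have hf : ∀ (c : ℂ) (k : ℤ) (f : ι → ι → g) , ∑ i, ∑ j,
      c • (gen F (KM.loop F k (f i j)) * gen F (KM.z F))
      = c • (gen F (KM.loop F k (∑ i, ∑ j, f i j)) * gen F (KM.z F)) := by
    intro c k f
    simp only [map_sum, Finset.sum_mul, Finset.smul_sum]
  rw [hl]
  simp only [h1, Finset.sum_add_distrib]
  rw [hf, hf, sum_dualGram_form_left, sum_dualGram_form_right, sum_dualGram_invariant F he hx, add_smul, adTerm, adTerm, ← sub_eq_add_neg, ← add_assoc]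
  congr 1
  · congr 1
    -- The cocycle sum contracts to `tⁿ x`, which may be written `tᵐ x` since its coefficient
    -- vanishes unless `m = n`; likewise for `-n` below.
    by_cases h : m = n
    · rw [h]
    · simp [h]
  · by_cases h : m = -n
    · rw [h]
    · simp [h]

/-- By invariance the second summand is minus a sum with factors `e_i` and `[x, e_j]`.
Supercommuting them, with `dualGram_swap` absorbing the signs, cancels the first summand and leaves
the double brackets that make up `A(x)`. The condition on `k + l` excludes the cocycle. -/
theorem adTerm_add_adTerm {a : ZMod 2} {x : g} (hx : x ∈ LieSuperalgebra.part (L := g) a)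
    {k l : ℤ} (hkl : k + l ≠ 0) :
    adTerm F e x k l + adTerm F e x l k = gen F (KM.loop F (k + l) (opA F e x)) := by
  have h := sum_dualGram_invariant F he hx (loopMul F l k)
  have h1 : ∀ i j, dualGram F e i j • (koszul a (p i) • loopMul F l k (e i) (br x (e j)))
      = dualGram F e j i • loopMul F k l (br x (e j)) (e i)
        - dualGram F e j i • gen F (KM.loop F (k + l) (br (br x (e j)) (e i))) := by
    intro i j
    by_cases hij : p i = p j
    · have hm := Env.inc_mul
        (show KM.loop F k (br x (e j)) ∈ part (a + p j) from KM.loop_mem_part _ (br_mem hx (he j)))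
        (show KM.loop F l (e i) ∈ part (p i) from KM.loop_mem_part _ (he i))
      rw [br_loop_loop, if_neg (by omega), zero_smul, add_zero] at hm
      rw [loopMul_apply, loopMul_apply, hm, dualGram_swap F he i j, koszul_comm (a + p j),
        koszul_add_right, hij, koszul_comm (p j) a, smul_add, add_sub_cancel_right,
        smul_smul, smul_smul]
      congr 1
      linear_combination -(dualGram F e i j) * koszul a (p j) * koszul_mul_self (p j) (p j)
    · simp [dualGram_eq_zero F he hij, dualGram_eq_zero F he (Ne.symm hij)]
  simp only [h1, Finset.sum_sub_distrib] at h
  rw [Finset.sum_comm, Finset.sum_comm (f := fun i j =>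
    dualGram F e j i • gen F (KM.loop F (k + l) (br (br x (e j)) (e i))))] at h
  rw [adTerm, adTerm, opA]
  simp only [map_sum, map_smul]
  rw [sub_eq_iff_eq_add] at h
  rw [h]; abel

end Commutators

/-! ### Telescoping sums with a reflection symmetry. -/

section Telescoping

variable {V : Type*} [AddCommGroup V]

/-- The boundary terms turn one of the two copies of the sum over `1, …, m` into the sum over `0, …,
m - 1`, and `n ↦ m - n` pairs the two ranges. -/
theorem sum_range_add_reflect {D : ℤ → V} {T : V} {m : ℕ} (hD : ∀ n, D n + D (m - n) = T) :
    D 0 - D m + 2 • ∑ n ∈ Finset.range m, D (n + 1) = m • T := by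
  have h1 : ∑ n ∈ Finset.range m, D n + ∑ n ∈ Finset.range m, D (n + 1) = m • T := by
    rw [← Finset.sum_range_reflect (fun n : ℕ => D (n + 1)), ← Finset.sum_add_distrib]
    rw [← Finset.card_range m, ← Finset.sum_const, Finset.card_range]
    refine Finset.sum_congr rfl fun n hn => ?_
    rw [← hD n]
    congr 2
    have := Finset.mem_range.1 hn
    omega
  have h2 : ∑ n ∈ Finset.range m, D (n + 1) = ∑ n ∈ Finset.range m, D n + D m - D 0 := by
    have h3 := Finset.sum_range_succ (fun n : ℕ => D n) m
    rw [Finset.sum_range_succ'] at h3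
    push_cast at h3
    rw [← h3]; abel
  rw [← h1, two_smul]
  nth_rewrite 1 [h2]
  abel

/-- The differences telescope to the first `m` terms minus the `m` terms beyond `N`; the latter lie
in `I`. -/
theorem telescope_mem_of_nonneg (I : AddSubgroup V) {D : ℤ → V} {T : V} {m : ℕ}
    (hD : ∀ n, D n + D (m - n) = T) (N : ℕ) (hI : ∀ n : ℤ, N < n → D n ∈ I) :
    D 0 - D m + 2 • ∑ n ∈ Finset.range N, (D (n + 1) - D (n + 1 + m)) - m • T ∈ I := by
  have h1 : ∑ n ∈ Finset.range N, (D (n + 1) - D (n + 1 + m))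
      = ∑ n ∈ Finset.range m, D (n + 1) - ∑ n ∈ Finset.range m, D (N + n + 1) := by
    rw [Finset.sum_sub_distrib]
    have ha := Finset.sum_range_add (fun n : ℕ => D (n + 1)) N m
    have hb := Finset.sum_range_add (fun n : ℕ => D (n + 1)) m N
    rw [add_comm m N, ha] at hb
    push_cast at hb
    have hc : ∑ n ∈ Finset.range N, D (n + 1 + m) = ∑ n ∈ Finset.range N, D (m + n + 1) :=
      Finset.sum_congr rfl fun n _ => by congr 1; ring
    rw [hc, sub_eq_sub_iff_add_eq_add, hb]
  have h2 := sum_range_add_reflect hD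
  have h3 : D 0 - D m + 2 • ∑ n ∈ Finset.range N, (D (n + 1) - D (n + 1 + m)) - m • T
      = -(2 • ∑ n ∈ Finset.range m, D (N + n + 1)) := by
    rw [h1, ← h2, smul_sub]; abel
  rw [h3]
  exact neg_mem (nsmul_mem (sum_mem fun n _ => hI _ (by omega)) _)

theorem telescope_mem (I : AddSubgroup V) {D : ℤ → V} {T : V} {m : ℤ}
    (hD : ∀ n, D n + D (m - n) = T) (N : ℕ) (hI : ∀ n : ℤ, N - m.natAbs < n → D n ∈ I) :
    D 0 - D m + 2 • ∑ n ∈ Finset.range N, (D (n + 1) - D (n + 1 + m)) - m • T ∈ I := by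
  obtain ⟨k, rfl | rfl⟩ := m.eq_nat_or_neg
  · have := telescope_mem_of_nonneg I hD N fun n hn => hI n (by omega)
    simpa using this
  -- For `m = -k` the shifted sequence `n ↦ D (n - k)` has the reflection symmetry about `k`, and
  -- the whole expression changes sign. The shift explains the bound `N - m.natAbs` in `hI`.
  · have := telescope_mem_of_nonneg I (D := fun n => D (n - k)) (T := T) (m := k)
      (fun n => by rw [← hD (n - k)]; congr 2; ring) N fun n hn => hI _ (by omega)
    rw [← neg_mem_iff]
    convert this using 1
    have h1 : ∑ n ∈ Finset.range N, (D (n + 1) - D (n + 1 + -(k : ℤ)))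
        = -∑ n ∈ Finset.range N, (D (n + 1 - k) - D (n + 1 + k - k)) := by
      rw [← Finset.sum_neg_distrib]
      refine Finset.sum_congr rfl fun n _ => ?_
      rw [neg_sub, add_sub_cancel_right, ← sub_eq_add_neg]
    rw [h1]
    simp only [zero_sub, sub_self, smul_neg, neg_smul, natCast_zsmul]
    abel

end Telescoping

/-! ### Convergence of the Casimir series and centrality. -/

section Center

variable {g : Type*} [AddCommGroup g] [Module ℂ g] [LieSuperalgebra g] (F : InvariantForm g)

theorem env_hasBasis_nhds_zero :
    (𝓝 (0 : Env (KM F))).HasBasis (fun _ => True) fun N : ℕ => (leftIdeal F N : Set (Env (KM F))) :=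
  (leftIdeal_basis F).hasBasis_nhds_zero

instance : NonarchimedeanRing (Env (KM F)) := (leftIdeal_basis F).nonarchimedean

variable {F}

theorem tendsto_zero_of_mem_leftIdeal {f : ℕ → Env (KM F)} (k : ℕ)
    (hf : ∀ n, f (n + k) ∈ leftIdeal F n) : Tendsto f atTop (𝓝 0) := by
  refine (env_hasBasis_nhds_zero F).tendsto_right_iff.2 fun N _ => ?_
  filter_upwards [eventually_ge_atTop (N + k)] with n hn
  have := hf (n - k)
  rw [Nat.sub_add_cancel (by omega)] at this
  exact leftIdeal_anti (by omega) this

theorem smul_mem_leftIdeal {N : ℕ} (c : ℂ) {w : Env (KM F)} (hw : w ∈ leftIdeal F N) :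
    c • w ∈ leftIdeal F N := by
  rw [Algebra.smul_def]; exact Ideal.mul_mem_left _ _ hw

theorem loopMul_mem_leftIdeal {N : ℕ} {k l : ℤ} (hl : (N : ℤ) ≤ l) (x y : g) :
    loopMul F k l x y ∈ leftIdeal F N :=
  Ideal.mul_mem_left _ _ (loop_mem_leftIdeal hl y)

theorem continuous_toHat : Continuous (toHat F) :=
  UniformSpace.Completion.continuous_coe _

theorem gen_mem_of_loop_u_z {S : Submodule ℂ (Env (KM F))} (hu : gen F (KM.u F) ∈ S)
    (hz : gen F (KM.z F) ∈ S)
    (hl : ∀ (m : ℤ) (a : ZMod 2), ∀ x ∈ LieSuperalgebra.part (L := g) a,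
      gen F (KM.loop F m x) ∈ S) (X : KM F) : gen F X ∈ S := by
  rw [KM.eq_sum X, gen_add, gen_add, gen_smul, gen_smul]
  refine add_mem (add_mem ?_ (S.smul_mem _ hu)) (S.smul_mem _ hz)
  rw [← Finsupp.sum_single X.loops, Finsupp.sum, map_sum]
  have : gen F (∑ n ∈ X.loops.support, KM.ofLoops F (Finsupp.single n (X.loops n)))
      = ∑ n ∈ X.loops.support, gen F (KM.loop F n (X.loops n)) := map_sum _ _ _
  rw [this]
  refine sum_mem fun n _ => ?_
  obtain ⟨y, hy, v, hv, h⟩ := exists_add_part (X.loops n)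
  rw [← h, map_add, gen_add]
  exact add_mem (hl n 0 y hy) (hl n 1 v hv)

/-- An element of the completion that commutes with the generators is central. -/
theorem mem_center_of_gen_commute {w : EnvHat F}
    (h : ∀ X, toHat F (gen F X) * w = w * toHat F (gen F X))
    (hc : ∀ c : ℂ, toHat F (algebraMap ℂ _ c) * w = w * toHat F (algebraMap ℂ _ c)) :
    w ∈ Subring.center (EnvHat F) := by
  rw [Subring.mem_center_iff]
  intro v
  induction v using UniformSpace.Completion.induction_on with
  | hp => exact isClosed_eq (continuous_id.mul continuous_const) (continuous_const.mul continuous_id)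
  | ih v =>
    change toHat F v * w = w * toHat F v
    induction v using Env.induction with
    | hc r => exact hc r
    | hi x => exact h x
    | hm x y hx hy => rw [map_mul, mul_assoc, hy, ← mul_assoc, hx, mul_assoc]
    | ha x y hx hy => rw [map_add, add_mul, mul_add, hx, hy]

variable {ι : Type*} [Fintype ι] [DecidableEq ι] (e : Module.Basis ι ℂ g)

theorem casimirTerm_mem_leftIdeal {N : ℕ} {n : ℤ} (hn : (N : ℤ) ≤ n) :
    casimirTerm F e n ∈ leftIdeal F N :=
  sum_mem fun _ _ => sum_mem fun _ _ => smul_mem_leftIdeal _ (loopMul_mem_leftIdeal hn _ _)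

theorem adTerm_mem_leftIdeal {N : ℕ} {k l : ℤ} (hl : (N : ℤ) ≤ l) (x : g) :
    adTerm F e x k l ∈ leftIdeal F N :=
  sum_mem fun _ _ => sum_mem fun _ _ => smul_mem_leftIdeal _ (loopMul_mem_leftIdeal hl _ _)

/-- In a complete nonarchimedean group it suffices that the terms tend to zero. -/
theorem summable_casimirTerm :
    Summable fun n : ℕ => toHat F (casimirTerm F e (n + 1)) := by
  refine NonarchimedeanAddGroup.summable_of_tendsto_cofinite_zero ?_
  rw [Nat.cofinite_eq_atTop, ← map_zero (toHat F)]
  exact (continuous_toHat.tendsto 0).comp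
    (tendsto_zero_of_mem_leftIdeal 0 fun n => casimirTerm_mem_leftIdeal e (by omega))

variable (F)

/-- The partial sums `Ω₀ + 2 ∑_{1 ≤ n ≤ N} Ω_n + 2 u ⊗ z + lam u` of the Casimir element. -/
def casimirPartial (lam : ℂ) (N : ℕ) : Env (KM F) :=
  casimirTerm F e 0 + 2 • ∑ n ∈ Finset.range N, casimirTerm F e (n + 1)
    + ((2 : ℂ) • (gen F (KM.u F) * gen F (KM.z F)) + lam • gen F (KM.u F))

theorem tendsto_casimirPartial (lam : ℂ) :
    Tendsto (fun N => toHat F (casimirPartial F e lam N)) atTop (𝓝 (casimir F e lam)) := by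
  have h := (summable_casimirTerm (F := F) e).hasSum.tendsto_sum_nat
  simp only [casimirPartial, map_add, map_nsmul, map_sum]
  unfold casimir casimirPM casimirZero
  rw [map_add, two_mul, ← two_nsmul]
  exact (tendsto_const_nhds.add (h.nsmul 2)).add tendsto_const_nhds

variable {F}

/-- Commutators with the partial sums tend to zero. The shift `k` allows for the filtration steps
lost when commuting with a loop of degree `m`. -/
theorem casimir_commute {lam : ℂ} {X : Env (KM F)} (k : ℕ)
    (h : ∀ N, X * casimirPartial F e lam (N + k) - casimirPartial F e lam (N + k) * X
      ∈ leftIdeal F N) :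
    toHat F X * casimir F e lam = casimir F e lam * toHat F X := by
  rw [← sub_eq_zero]
  have h1 := ((tendsto_casimirPartial F e lam).const_mul (toHat F X)).sub
    ((tendsto_casimirPartial F e lam).mul_const (toHat F X))
  have h2 := (continuous_toHat.tendsto 0).comp (tendsto_zero_of_mem_leftIdeal (F := F)
    (f := fun N => X * casimirPartial F e lam N - casimirPartial F e lam N * X) k h)
  rw [map_zero] at h2
  refine tendsto_nhds_unique h1 (h2.congr fun N => ?_)
  simp

variable {e} {p : ι → ZMod 2} (he : ∀ i, e i ∈ LieSuperalgebra.part (L := g) (p i))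

/-- The two factors have opposite degrees, so each product has degree zero. -/
theorem u_commute_casimirTerm (n : ℤ) :
    gen F (KM.u F) * casimirTerm F e n - casimirTerm F e n * gen F (KM.u F) = 0 := by
  simp only [casimirTerm, Finset.mul_sum, Finset.sum_mul, ← Finset.sum_sub_distrib,
    mul_smul_comm, smul_mul_assoc, ← smul_sub]
  refine Finset.sum_eq_zero fun i _ => Finset.sum_eq_zero fun j _ => ?_
  have h1 := gen_u_loop (F := F) (-n) (e i)
  have h2 := gen_u_loop (F := F) n (e j)
  rw [sub_eq_iff_eq_add] at h1 h2
  rw [← mul_assoc, h1, add_mul, mul_assoc, h2, mul_add, mul_smul_comm, smul_mul_assoc, mul_assoc]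
  push_cast
  module

include he in
theorem loop_commutator_casimirPartial {lam : ℂ} (hA : ∀ x : g, opA F e x = lam • x)
    {a : ZMod 2} {x : g} (hx : x ∈ LieSuperalgebra.part (L := g) a) (m : ℤ) (N : ℕ) :
    gen F (KM.loop F m x) * casimirPartial F e lam (N + m.natAbs)
      - casimirPartial F e lam (N + m.natAbs) * gen F (KM.loop F m x) ∈ leftIdeal F N := by
  set X := gen F (KM.loop F m x) with hX
  set K := N + m.natAbs with hK
  have hu := gen_u_loop (F := F) m x
  have h1 : X * casimirPartial F e lam K - casimirPartial F e lam K * X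
      = (X * casimirTerm F e 0 - casimirTerm F e 0 * X)
        + 2 • ∑ n ∈ Finset.range K,
          (X * casimirTerm F e (n + 1) - casimirTerm F e (n + 1) * X)
        - (2 * (m : ℂ)) • (X * gen F (KM.z F)) - (m * lam) • X := by
    have h2 : X * (gen F (KM.u F) * gen F (KM.z F)) - gen F (KM.u F) * gen F (KM.z F) * X
        = -((m : ℂ) • (X * gen F (KM.z F))) := by
      rw [mul_assoc, gen_z_comm, ← mul_assoc, ← mul_assoc, ← sub_mul, ← neg_sub, hu, neg_mul,
        smul_mul_assoc]
    have h3 : X * gen F (KM.u F) - gen F (KM.u F) * X = -((m : ℂ) • X) := by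
      rw [← hu, neg_sub]
    rw [sub_eq_iff_eq_add] at h2 h3
    simp only [casimirPartial, mul_add, add_mul, mul_smul_comm, smul_mul_assoc, h2, h3,
      Finset.sum_sub_distrib, Finset.mul_sum, Finset.sum_mul]
    module
  -- Since `K ≥ |m|`, a nonzero `m` equals `±(n + 1)` for exactly one `n` in the range, so the
  -- cocycle contributes `m` once; doubled, this cancels the term from `2 u ⊗ z`.
  have hz : ∑ n ∈ Finset.range K, ((if m = ((n : ℤ) + 1) then (m : ℂ) else 0)
      + (if m = -((n : ℤ) + 1) then (m : ℂ) else 0)) = m := by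
    obtain ⟨k, rfl | rfl⟩ := m.eq_nat_or_neg
    · rcases k with _ | k
      · simp
      · rw [Finset.sum_eq_single_of_mem k (by simp [hK]; omega)]
        · rw [if_pos (by push_cast; ring), if_neg (by omega), add_zero]
        · intro n _ hn
          rw [if_neg (by omega), if_neg (by omega), add_zero]
    · rcases k with _ | k
      · simp
      · rw [Finset.sum_eq_single_of_mem k (by simp [hK]; omega)]
        · rw [if_neg (by omega), if_pos (by push_cast; ring), zero_add]
        · intro n _ hn
          rw [if_neg (by omega), if_neg (by omega), add_zero]
  set D : ℤ → Env (KM F) := fun n => adTerm F e x (m - n) n with hDdef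
  have hcomm : ∀ n : ℤ, X * casimirTerm F e n - casimirTerm F e n * X = D n - D (n + m)
      + ((if m = n then (m : ℂ) else 0) + (if m = -n then (m : ℂ) else 0)) •
        (X * gen F (KM.z F)) := by
    intro n
    rw [hX, loop_commutator_casimirTerm he hx, hDdef]
    simp only
    rw [show m - (n + m) = -n by ring, add_comm n m]
  have h0 : X * casimirTerm F e 0 - casimirTerm F e 0 * X = D 0 - D m := by
    rw [hcomm, zero_add]
    by_cases h : m = 0 <;> simp [h]
  rw [h1, h0]
  simp only [hcomm, Finset.sum_add_distrib, ← Finset.sum_smul, hz]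
  -- For `m = 0` every difference `D n - D (n + m)` is zero; the reflection identity is only
  -- available for `m ≠ 0`.
  by_cases hm : m = 0
  · simp [hm]
  have hD : ∀ n, D n + D (m - n) = lam • X := by
    intro n
    rw [hDdef]
    simp only
    rw [show m - (m - n) = n by ring, adTerm_add_adTerm he hx (by omega), hA,
      show m - n + n = m by ring, map_smul, gen_smul]
  -- The choice `K = N + |m|` makes the bound `K - |m| < n` read `N < n`.
  have := telescope_mem (leftIdeal F N).toAddSubgroup hD K fun n hn =>
    adTerm_mem_leftIdeal e (by omega) x
  refine Eq.mp (congrArg (· ∈ leftIdeal F N) ?_) this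
  rw [← Int.cast_smul_eq_zsmul ℂ m (lam • X)]
  module

include he in
theorem casimir_mem_center {lam : ℂ} (hA : ∀ x : g, opA F e x = lam • x) :
    casimir F e lam ∈ Subring.center (EnvHat F) := by
  have hc : ∀ c : ℂ, toHat F (algebraMap ℂ _ c) * casimir F e lam
      = casimir F e lam * toHat F (algebraMap ℂ _ c) := fun c =>
    casimir_commute e 0 fun N => by rw [Algebra.commutes, sub_self]; exact zero_mem _
  let S : Submodule ℂ (Env (KM F)) :=
    { carrier := {X | toHat F X * casimir F e lam = casimir F e lam * toHat F X}
      add_mem' := fun {X Y} hX hY => by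
        simp only [Set.mem_ofPred_eq] at hX hY ⊢
        rw [map_add, add_mul, mul_add, hX, hY]
      zero_mem' := by simp
      smul_mem' := fun c X hX => by
        simp only [Set.mem_ofPred_eq] at hX ⊢
        rw [Algebra.smul_def, map_mul, mul_assoc, hX, ← mul_assoc, hc, mul_assoc] }
  refine mem_center_of_gen_commute (fun X => ?_) hc
  refine gen_mem_of_loop_u_z (S := S) ?_ ?_ (fun m a x hx => ?_) X
  · refine casimir_commute e 0 fun N => ?_
    have h0 : gen F (KM.u F) * casimirPartial F e lam (N + 0)
        - casimirPartial F e lam (N + 0) * gen F (KM.u F) = 0 := by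
      have h1 : ∀ n, gen F (KM.u F) * casimirTerm F e n = casimirTerm F e n * gen F (KM.u F) :=
        fun n => sub_eq_zero.1 (u_commute_casimirTerm n)
      simp only [casimirPartial, mul_add, add_mul, mul_smul_comm, smul_mul_assoc, mul_assoc,
        gen_z_comm, h1, Finset.mul_sum, Finset.sum_mul, sub_self]
    rw [h0]; exact zero_mem _
  · refine casimir_commute e 0 fun N => ?_
    have h1 : ∀ w : Env (KM F), gen F (KM.z F) * w = w * gen F (KM.z F) := by
      intro w
      induction w using Env.induction with
      | hc r => exact (Algebra.commutes _ _).symm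
      | hi x => exact gen_z_comm x
      | hm x y hx hy => rw [← mul_assoc, hx, mul_assoc, hy, mul_assoc]
      | ha x y hx hy => rw [mul_add, add_mul, hx, hy]
    rw [h1, sub_self]; exact zero_mem _
  · exact casimir_commute e m.natAbs fun N => loop_commutator_casimirPartial he hA hx m N

end Center

/-- The universal property of the enveloping algebra. -/
def Env.lift {L : Type*} [AddCommGroup L] [Module ℂ L] [LieSuperalgebra L] {A : Type*} [Ring A]
    [Algebra ℂ A] (f : L →ₗ[ℂ] A)
    (hf : ∀ (a b : ZMod 2) (x y : L), x ∈ part a → y ∈ part b →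
      f x * f y = koszul a b • (f y * f x) + f (br x y)) : Env L →ₐ[ℂ] A :=
  RingQuot.liftAlgHom ℂ ⟨TensorAlgebra.lift ℂ f, by
    rintro _ _ ⟨hx, hy⟩
    simpa using hf _ _ _ _ hx hy⟩

theorem Env.lift_inc {L : Type*} [AddCommGroup L] [Module ℂ L] [LieSuperalgebra L] {A : Type*}
    [Ring A] [Algebra ℂ A] (f : L →ₗ[ℂ] A)
    (hf : ∀ (a b : ZMod 2) (x y : L), x ∈ part a → y ∈ part b →
      f x * f y = koszul a b • (f y * f x) + f (br x y)) (x : L) :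
    Env.lift f hf (Env.inc L x) = f x :=
  (RingQuot.liftAlgHom_mkAlgHom_apply ℂ _ _ _).trans (TensorAlgebra.lift_ι_apply f x)

/-! ### Uniqueness of the `u`-coefficient via dual numbers. -/

section UCoeff

variable {g : Type*} [AddCommGroup g] [Module ℂ g] [LieSuperalgebra g] (F : InvariantForm g)

theorem uCoeff_br (X Y : KM F) : (br X Y).uCoeff = 0 := by
  have h1 : ∀ f : ℤ →₀ g, (KM.degMap F f).uCoeff = 0 := by
    intro f
    induction f using Finsupp.induction_linear with
    | zero => simp
    | add f f' h h' => simp [h, h']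
    | single n x => simp [KM.degMap]
  have h2 : ∀ f f' : ℤ →₀ g, (KM.loopsBr F f f').uCoeff = 0 := by
    intro f f'
    induction f using Finsupp.induction_linear with
    | zero => simp
    | add f f' h h' => simp [h, h']
    | single m x =>
      induction f' using Finsupp.induction_linear with
      | zero => simp
      | add f f' h h' => simp [h, h']
      | single n y =>
        simp only [KM.loopsBr, KM.loopBr, Finsupp.lsum_apply, Finsupp.sum_single_index, map_zero,
          LinearMap.flip_apply, LinearMap.add_apply, LinearMap.compr₂_apply,
          LinearMap.toSpanSingleton_apply, KM.add_uCoeff, KM.loop_uCoeff, KM.smul_uCoeff,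
          KM.z_uCoeff, mul_zero, add_zero]
  have h3 : br X Y = KM.loopsBr F X.loops Y.loops + X.uCoeff • KM.degMap F Y.loops
      + (-Y.uCoeff) • KM.degMap F X.loops := by
    rw [neg_smul, ← sub_eq_add_neg]; rfl
  rw [h3]
  simp only [KM.add_uCoeff, KM.smul_uCoeff, h1, h2, mul_zero, add_zero]

/-- The linear map `X ↦ X.uCoeff ε` with values in the dual numbers. -/
def uCoeffEps : KM F →ₗ[ℂ] DualNumber ℂ where
  toFun X := TrivSqZeroExt.inr X.uCoeff
  map_add' X Y := TrivSqZeroExt.inr_add ℂ X.uCoeff Y.uCoeff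
  map_smul' c X := TrivSqZeroExt.inr_smul ℂ c X.uCoeff

/-- The algebra homomorphism `U(ĝ) → ℂ[ε]` with `X ↦ X.uCoeff ε`. -/
def toDualNumber : Env (KM F) →ₐ[ℂ] DualNumber ℂ :=
  Env.lift (uCoeffEps F) fun a b X Y _ _ => by simp [uCoeffEps, uCoeff_br]

variable {F}

theorem toDualNumber_gen (X : KM F) :
    toDualNumber F (gen F X) = TrivSqZeroExt.inr X.uCoeff :=
  Env.lift_inc _ _ X

/-- This is `ε² = 0`, the reason for taking values in dual numbers. -/
theorem toDualNumber_gen_mul_gen (X Y : KM F) : toDualNumber F (gen F X * gen F Y) = 0 := by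
  rw [map_mul, toDualNumber_gen, toDualNumber_gen, TrivSqZeroExt.inr_mul_inr]

theorem toDualNumber_eq_zero {N : ℕ} {w : Env (KM F)} (hw : w ∈ leftIdeal F N) :
    toDualNumber F w = 0 := by
  have : leftIdeal F N ≤ RingHom.ker (toDualNumber F) := by
    refine Ideal.span_le.2 ?_
    rintro _ ⟨n, _, x, rfl⟩
    simp [toDualNumber_gen]
  exact this hw

/-- A convergent sum of quadratic terms is equal to an element of `ĝ` only if the latter
has no component along `u`. -/
theorem uCoeff_eq_zero_of_hasSum {κ : Type*} {c : κ → ℂ} {X Y : κ → KM F} {l : KM F}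
    (h : HasSum (fun q => toHat F (c q • (gen F (X q) * gen F (Y q)))) (toHat F (gen F l))) :
    l.uCoeff = 0 := by
  -- The topology of `U(ĝ)` is induced from the completion, so the convergence already takes place
  -- in `U(ĝ)`.
  have h1 : HasSum (fun q => c q • (gen F (X q) * gen F (Y q))) (gen F l) := by
    have hi := (UniformSpace.Completion.isUniformInducing_coe (Env (KM F))).isInducing
    exact (hi.hasSum_iff (g := toHat F) _ _).1 h
  have h2 : Tendsto (fun s : Finset κ => ∑ q ∈ s, c q • (gen F (X q) * gen F (Y q)) - gen F l)
      atTop (𝓝 0) := by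
    rw [← sub_self (gen F l)]
    exact Tendsto.sub_const h1 _
  -- The largest ideal, `N = 0`, suffices: a single partial sum congruent to `l` modulo it
  -- determines the `u`-coefficient.
  obtain ⟨s, hs⟩ := ((env_hasBasis_nhds_zero F).tendsto_right_iff.1 h2 0 trivial).exists
  have h3 := toDualNumber_eq_zero hs
  simp only [map_sub, map_sum, map_smul, toDualNumber_gen_mul_gen, smul_zero,
    Finset.sum_const_zero, toDualNumber_gen, zero_sub, neg_eq_zero] at h3
  simpa using congrArg TrivSqZeroExt.snd h3

end UCoeff

/-! ### Existence and comparison of Wick normal forms. -/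

section Wick

variable {g : Type*} [AddCommGroup g] [Module ℂ g] [LieSuperalgebra g] {F : InvariantForm g}
  {ι : Type*} {e : Module.Basis ι ℂ g} {r : ι → ι → Prop}

theorem IsWickLinearTerm.add {w w' : EnvHat F} {l l' : KM F} (h : IsWickLinearTerm F e r w l)
    (h' : IsWickLinearTerm F e r w' l') : IsWickLinearTerm F e r (w + w') (l + l') := by
  obtain ⟨c, hc, hs⟩ := h
  obtain ⟨c', hc', hs'⟩ := h'
  refine ⟨fun X Y => c X Y + c' X Y, fun X Y hXY => ?_, ?_⟩
  · by_cases hX : c X Y = 0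
    · exact hc' X Y fun hY => hXY (by rw [hX, hY, add_zero])
    · exact hc X Y hX
  · have := hs.add hs'
    simp only [add_smul, map_add]
    rwa [add_sub_add_comm]

theorem IsWickLinearTerm.smul (a : ℂ) {w : EnvHat F} {l : KM F} (h : IsWickLinearTerm F e r w l) :
    IsWickLinearTerm F e r (toHat F (algebraMap ℂ _ a) * w) (a • l) := by
  obtain ⟨c, hc, hs⟩ := h
  refine ⟨fun X Y => a * c X Y, fun X Y hXY => hc X Y (right_ne_zero_of_mul hXY), ?_⟩
  have := hs.mul_left (toHat F (algebraMap ℂ _ a))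
  simp only [mul_sub, ← map_mul, ← Algebra.smul_def, smul_smul] at this
  rwa [gen_smul]

theorem IsWickLinearTerm.neg {w : EnvHat F} {l : KM F} (h : IsWickLinearTerm F e r w l) :
    IsWickLinearTerm F e r (-w) (-l) := by
  simpa using h.smul (-1)

theorem isWickLinearTerm_gen (l : KM F) : IsWickLinearTerm F e r (toHat F (gen F l)) l :=
  ⟨fun _ _ => 0, fun _ _ h => absurd rfl h, by simp [hasSum_zero]⟩

theorem isWickLinearTerm_mul {X Y : KMIndex ι} (h : IsNormalOrdered r X Y) :
    IsWickLinearTerm F e r (toHat F (gen F (X.vec F e) * gen F (Y.vec F e))) 0 := by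
  classical
  refine ⟨fun X' Y' => if (X', Y') = (X, Y) then 1 else 0, fun X' Y' h' => ?_, ?_⟩
  · rw [ne_eq, ite_eq_right_iff, Classical.not_imp, Prod.mk.injEq] at h'
    rw [h'.1.1, h'.1.2]; exact h
  · rw [show gen F 0 = 0 from map_zero _, map_zero, sub_zero]
    convert hasSum_single (X, Y) fun q hq => ?_ using 1
    · simp
    · simp [hq]

theorem isWickLinearTerm_sum {κ : Type*} (s : Finset κ) {w : κ → EnvHat F} {l : κ → KM F}
    (h : ∀ i ∈ s, IsWickLinearTerm F e r (w i) (l i)) :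
    IsWickLinearTerm F e r (∑ i ∈ s, w i) (∑ i ∈ s, l i) := by
  classical
  induction s using Finset.induction_on with
  | empty => simpa using isWickLinearTerm_gen (F := F) (e := e) (r := r) 0
  | insert i s hi ih =>
    rw [Finset.sum_insert hi, Finset.sum_insert hi]
    exact (h i (Finset.mem_insert_self i s)).add
      (ih fun j hj => h j (Finset.mem_insert_of_mem hj))

/-- A forbidden product of distinct elements is supercommuted into the allowed order at the cost of
a bracket. A forbidden square must be that of an odd element, and equals half of its bracket with
itself. -/
theorem exists_isWickLinearTerm_loop_zero_mul {p : ι → ZMod 2}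
    (he : ∀ i, e i ∈ LieSuperalgebra.part (L := g) (p i)) (hr : IsOrderingRule p r) (i j : ι) :
    ∃ l, IsWickLinearTerm F e r
      (toHat F (gen F (KM.loop F 0 (e i)) * gen F (KM.loop F 0 (e j)))) l := by
  have hord : ∀ i j, r i j → IsWickLinearTerm F e r
      (toHat F (gen F (KM.loop F 0 (e i)) * gen F (KM.loop F 0 (e j)))) 0 := by
    intro i j hij
    refine isWickLinearTerm_mul (X := .loop 0 i) (Y := .loop 0 j) ⟨le_rfl, le_rfl, ?_⟩
    rintro _ _ ⟨⟩ ⟨⟩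
    exact hij
  have hmul := Env.inc_mul
    (show KM.loop F 0 (e i) ∈ part (p i) from KM.loop_mem_part _ (he i))
    (show KM.loop F 0 (e j) ∈ part (p j) from KM.loop_mem_part _ (he j))
  by_cases hij : r i j
  · exact ⟨0, hord i j hij⟩
  by_cases h : i = j
  · subst h
    have hp : p i = 1 := by
      have hz : ∀ a : ZMod 2, a = 0 ∨ a = 1 := by decide
      exact (hz (p i)).resolve_left fun h0 => hij (hr.sq i h0)
    have hk : koszul (p i) (p i) = -1 := by simp [hp, koszul]
    rw [hk] at hmul
    have h2 : gen F (KM.loop F 0 (e i)) * gen F (KM.loop F 0 (e i))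
        = gen F ((1 / 2 : ℂ) • br (KM.loop F 0 (e i)) (KM.loop F 0 (e i))) := by
      rw [gen_smul]
      rw [eq_comm, ← eq_sub_iff_add_eq'] at hmul
      rw [show gen F (br (KM.loop F 0 (e i)) (KM.loop F 0 (e i))) = _ from hmul]
      module
    rw [h2]
    exact ⟨_, isWickLinearTerm_gen _⟩
  · have hji := (hr.total i j h).resolve_left hij
    rw [show gen F (KM.loop F 0 (e i)) * gen F (KM.loop F 0 (e j)) = _ from hmul, map_add,
      Algebra.smul_def, map_mul]
    exact ⟨_, ((hord j i hji).smul _).add (isWickLinearTerm_gen _)⟩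

variable [Fintype ι] [DecidableEq ι]

theorem exists_isWickLinearTerm_casimirZero {p : ι → ZMod 2}
    (he : ∀ i, e i ∈ LieSuperalgebra.part (L := g) (p i)) (hr : IsOrderingRule p r) :
    ∃ l, IsWickLinearTerm F e r (casimirZero F e) l := by
  choose l hl using exists_isWickLinearTerm_loop_zero_mul (F := F) he hr
  refine ⟨∑ i, ∑ j, dualGram F e i j • l i j, ?_⟩
  simp only [casimirZero, casimirTerm, map_sum, neg_zero, Algebra.smul_def, map_mul]
  simp only [← map_mul (toHat F) (gen F _)]
  exact isWickLinearTerm_sum _ fun i _ => isWickLinearTerm_sum _ fun j _ => (hl i j).smul _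

/-- The defining series is already normally ordered; what remains is to rearrange it as an
unconditional sum over pairs of basis elements. -/
theorem isWickLinearTerm_casimirPM : IsWickLinearTerm F e r (casimirPM F e) 0 := by
  let φ : ℕ × (ι × ι) → KMIndex ι × KMIndex ι :=
    fun q => (.loop (-((q.1 : ℤ) + 1)) q.2.1, .loop (q.1 + 1) q.2.2)
  have hφ : Function.Injective φ := by
    rintro ⟨n, i, j⟩ ⟨n', i', j'⟩ h
    simp only [φ, Prod.mk.injEq, KMIndex.loop.injEq] at h
    obtain ⟨⟨_, rfl⟩, h, rfl⟩ := h
    have : n = n' := by omega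
    rw [this]
  refine ⟨fun X Y => Function.extend φ (fun q => dualGram F e q.2.1 q.2.2) 0 (X, Y),
    fun X Y h => ?_, ?_⟩
  · by_cases hXY : ∃ q, φ q = (X, Y)
    · obtain ⟨⟨n, i, j⟩, hq⟩ := hXY
      simp only [φ, Prod.mk.injEq] at hq
      obtain ⟨rfl, rfl⟩ := hq
      refine ⟨?_, ?_, fun i' j' h1 h2 => ?_⟩
      · simp only [KMIndex.deg]; omega
      · simp only [KMIndex.deg]; omega
      -- The second factor has degree `n + 1 > 0`, so the ordering rule on `g` does not apply.
      · simp only [KMIndex.loop.injEq] at h2; omega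
    · exact absurd (Function.extend_apply' _ _ _ hXY) h
  · rw [show gen F 0 = 0 from map_zero _, map_zero, sub_zero, ← hφ.hasSum_iff]
    · have hfun : ((fun q : KMIndex ι × KMIndex ι => toHat F
          (Function.extend φ (fun q => dualGram F e q.2.1 q.2.2) 0 (q.1, q.2) •
            (gen F (q.1.vec F e) * gen F (q.2.vec F e)))) ∘ φ)
          = fun q : ℕ × (ι × ι) => toHat F (dualGram F e q.2.1 q.2.2 •
            (gen F (KM.loop F (-((q.1 : ℤ) + 1)) (e q.2.1))
              * gen F (KM.loop F (q.1 + 1) (e q.2.2)))) := by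
        funext q
        simp only [Function.comp_apply, Prod.mk.eta, hφ.extend_apply]
        rfl
      rw [hfun]
      have hsum : Summable fun q : ℕ × (ι × ι) => toHat F (dualGram F e q.2.1 q.2.2 •
            (gen F (KM.loop F (-((q.1 : ℤ) + 1)) (e q.2.1))
              * gen F (KM.loop F (q.1 + 1) (e q.2.2)))) := by
        refine NonarchimedeanAddGroup.summable_of_tendsto_cofinite_zero ?_
        rw [← map_zero (toHat F)]
        refine (continuous_toHat.tendsto 0).comp ?_
        refine (env_hasBasis_nhds_zero F).tendsto_right_iff.2 fun N _ => ?_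
        rw [eventually_cofinite]
        -- Only the finitely many triples with `n < N` can lie outside `leftIdeal F N`.
        refine ((Set.finite_lt_nat N).prod (Set.finite_univ (α := ι × ι))).subset ?_
        rintro ⟨n, i, j⟩ hq
        refine ⟨?_, trivial⟩
        by_contra hn
        refine hq (smul_mem_leftIdeal _ (loopMul_mem_leftIdeal ?_ _ _))
        simp only [Set.mem_ofPred_eq] at hn
        omega
      -- Summing first over `(i, j)` for fixed `n` recovers the series that defines `casimirPM`.
      have h1 := hsum.hasSum.prod_fiberwise fun n => hasSum_fintype _
      have h2 : casimirPM F e = _ := Eq.trans ?_ h1.tsum_eq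
      · rw [h2]; exact hsum.hasSum
      · unfold casimirPM
        congr 1
        funext n
        rw [Fintype.sum_prod_type, casimirTerm, map_sum]
        simp only [map_sum]
    · intro q hq
      rw [Function.extend_apply' _ _ _ (by simpa using hq)]
      simp

theorem isWickLinearTerm_casimir_sub (lam : ℂ) :
    IsWickLinearTerm F e r (casimir F e lam - casimirZero F e) (lam • KM.u F) := by
  have huz : IsNormalOrdered r (KMIndex.u : KMIndex ι) .z := ⟨le_rfl, le_rfl, by simp⟩
  have h := ((isWickLinearTerm_casimirPM (F := F) (e := e) (r := r)).add
    isWickLinearTerm_casimirPM).add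
    (((isWickLinearTerm_mul (F := F) (e := e) huz).smul 2).add
      (isWickLinearTerm_gen (lam • KM.u F)))
  simp only [smul_zero, add_zero, zero_add] at h
  convert h using 1
  rw [casimir, map_add, Algebra.smul_def, map_mul, gen_smul, two_mul]
  simp only [KMIndex.vec]
  abel

theorem isWickLinearTerm_casimir_iff {lam : ℂ} {l : KM F} :
    IsWickLinearTerm F e r (casimirZero F e) l ↔
      IsWickLinearTerm F e r (casimir F e lam) (l + lam • KM.u F) := by
  constructor
  · intro h
    simpa using h.add (isWickLinearTerm_casimir_sub lam)
  · intro h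
    simpa using h.add (isWickLinearTerm_casimir_sub lam).neg

omit [Fintype ι] [DecidableEq ι] in
-- Subtracting the two normal forms writes the difference of the linear terms as a convergent sum of
-- quadratic terms.
theorem IsWickLinearTerm.uCoeff_eq {w : EnvHat F} {l l' : KM F} (h : IsWickLinearTerm F e r w l)
    (h' : IsWickLinearTerm F e r w l') : l.uCoeff = l'.uCoeff := by
  obtain ⟨c, -, hs⟩ := h.add h'.neg
  rw [add_neg_cancel, zero_sub, ← map_neg, ← map_neg] at hs
  have := uCoeff_eq_zero_of_hasSum hs
  have h1 : -(l + -l') = (-1 : ℂ) • l + l' := by module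
  rw [h1] at this
  simp only [KM.add_uCoeff, KM.smul_uCoeff] at this
  linear_combination -this

end Wick

end KacMoodySuper
end

open KacMoodySuper in
theorem mainTheorem1 {g : Type*} [AddCommGroup g] [Module ℂ g] [LieSuperalgebra g]
    (F : InvariantForm g) {ι : Type*} [Fintype ι] [DecidableEq ι]
    (e : Module.Basis ι ℂ g) (p : ι → ZMod 2)
    (he : ∀ i, e i ∈ LieSuperalgebra.part (L := g) (p i))
    (lam : ℂ) (hA : ∀ x : g, opA F e x = lam • x) :
    Summable (fun n : ℕ => toHat F (casimirTerm F e (n + 1))) ∧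
    casimir F e lam ∈ Subring.center (EnvHat F) ∧
    ∀ r : ι → ι → Prop, IsOrderingRule p r →
      (∃ l₀, IsWickLinearTerm F e r (casimirZero F e) l₀) ∧
      (∃ l, IsWickLinearTerm F e r (casimir F e lam) l) ∧
      (∀ l₀, IsWickLinearTerm F e r (casimirZero F e) l₀ ↔
        IsWickLinearTerm F e r (casimir F e lam) (l₀ + lam • KM.u F)) ∧
      (∀ l₀ l, IsWickLinearTerm F e r (casimirZero F e) l₀ →
        IsWickLinearTerm F e r (casimir F e lam) l → l.uCoeff = l₀.uCoeff + lam) := by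
  refine ⟨summable_casimirTerm e, casimir_mem_center he hA, fun r hr => ?_⟩
  obtain ⟨l₀, hl₀⟩ := exists_isWickLinearTerm_casimirZero (F := F) he hr
  refine ⟨⟨l₀, hl₀⟩, ⟨_, isWickLinearTerm_casimir_iff.1 hl₀⟩,
    fun _ => isWickLinearTerm_casimir_iff, fun l₀ l h₀ h => ?_⟩
  simpa using h.uCoeff_eq (isWickLinearTerm_casimir_iff.1 h₀)
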